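/- **Mal'cev's theorem for local Lie groupoids.** Manifolds are smooth, finite-dimensional, of constant dimension, without boundary and second countable. Manifolds of objects are Hausdorff; manifolds of arrows need not be, but all source and target fibres are required to be Hausdorff. A *local Lie groupoid* $G$ over a manifold $M$ is a manifold $G$ with smooth submersions $s,t:G\to M$ (source, target), a smooth map $u:M\to G$ (units) with $s\circ u=t\circ u=\mathrm{id}_M$, an open subset $\mathcal U$ of the fibre product $G\times_M G=\{(g,h): s(g)=t(h)\}$ that contains $(g,u(s(g)))$ and $(u(t(g)),g)$ for all $g\in G$, a submersion $m:\mathcal U\to G$, $(g,h)\mapsto gh$, an open neighbourhood $\mathcal V$ of $u(M)$ in $G$ such that $(g,h)\in\mathcal U$ whenever $g,h\in\mathcal V$ and $s(g)=t(h)$, and a smooth map $i:\mathcal V\to\mathcal V$, such that - $s(gh)=s(h)$ and $t(gh)=t(g)$ for $(g,h)\in\mathcal U$, and $g\,u(s(g))=u(t(g))\,g=g$ for $g\in G$; - $(gh)k=g(hk)$ (both sides being defined) for all $(g,h,k)$ in some neighbourhood, in $\{(g,h,k)\in G^3: s(g)=t(h),\ s(h)=t(k)\}$, of the set of all triples $(u(t(g)),u(t(g)),g)$,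 $(u(t(g)),g,u(s(g)))$, $(g,u(s(g)),u(s(g)))$ with $g\in G$; - $s(i(g))=t(g)$, $t(i(g))=s(g)$, $i(g)\,g=u(s(g))$ and $g\,i(g)=u(t(g))$ for $g\in\mathcal V$. A *Lie groupoid* over $M$ is a groupoid with object set $M$ whose set of arrows is a manifold, with $s,t$ smooth submersions and with smooth multiplication (on all composable pairs), inversion and units. $G$ is *strongly connected* if - (a) $M$ is connected; - (b) $\mathcal U$ and $\mathcal V$ are connected; - (c) $\{(g,h)\in\mathcal U: s(g)=t(h)=x\}$ is connected for every $x\in M$; - (d) all fibres $s^{-1}(x)$ and $t^{-1}(x)$, $x\in M$, are connected; - (e) $G$ is bi-regular: for every $g\in G$, the differential of right multiplication by $g$ is an isomorphism $\ker(ds)_{u(t(g))}\to\ker(ds)_g$, and the differential of left multiplication by $g$ is an isomorphism $\ker(dt)_{u(s(g))}\to\ker(dt)_g$. $G$ is *globally associative* if for every $n\ge 3$ and every $(x_1,\dots,x_n)\in G^n$, all ways of putting brackets in $x_1\cdots x_n$ for which every partial product is defined give the same element of $G$. $G$ is *globalizable* if it is a restriction of an open neighbourhood of the units in a Lie groupoid: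 there are a Lie groupoid $\mathcal G$ over $M$, an open set $U\subset\mathcal G$ containing all units, and a diffeomorphism $G\cong U$ that carries $s$, $t$, $u$ to the source, target and unit maps of $\mathcal G$, and under which $m$ (on $\mathcal U$) and $i$ (on $\mathcal V$) are restrictions of the multiplication and inversion of $\mathcal G$. **Theorem.** A strongly connected local Lie groupoid is globalizable if and only if it is globally associative. -/

import Mathlib

open scoped Manifold ContDiff

universe u v

/-- A smooth submersion between finite-dimensional manifolds without boundary: a smooth map whose
differential is surjective at every point. -/
def IsSmoothSubmersion {n k : ℕ} {G : Type u} {M : Type v}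
    [TopologicalSpace G] [ChartedSpace (EuclideanSpace ℝ (Fin n)) G]
    [TopologicalSpace M] [ChartedSpace (EuclideanSpace ℝ (Fin k)) M] (f : G → M) : Prop :=
  ContMDiff (𝓡 n) (𝓡 k) ∞ f ∧ ∀ g : G, Function.Surjective (mfderiv (𝓡 n) (𝓡 k) f g)

/-- A local Lie groupoid with manifold of arrows `G` (of dimension `n`) and manifold of objects `M`
(of dimension `k`). Arrows go from right to left: `g h` makes sense only if `s g = t h`.
The partially defined operations are functions on all of `G` (or `G × G`) of which only the values
on the domains `mulDom` (the set `𝒰`) and `invDom` (the set `𝒱`) are ever used. -/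
structure LocalLieGroupoid (n k : ℕ) (G : Type u) (M : Type v)
    [TopologicalSpace G] [ChartedSpace (EuclideanSpace ℝ (Fin n)) G]
    [TopologicalSpace M] [ChartedSpace (EuclideanSpace ℝ (Fin k)) M] where
  /-- the source map `s` -/
  source : G → M
  /-- the target map `t` -/
  target : G → M
  /-- the unit map `u` -/
  unit : M → G
  /-- the domain `𝒰` of the multiplication -/
  mulDom : Set (G × G)
  /-- the multiplication `m`, meaningful on `𝒰` only -/
  mul : G → G → G
  /-- the domain `𝒱` of the inversion -/
  invDom : Set G
  /-- the inversion `i`, meaningful on `𝒱` only -/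
  inv : G → G
  /-- The space of arrows need not be Hausdorff, but the source fibres are. -/
  t2_source_fiber : ∀ x : M, T2Space (source ⁻¹' {x})
  t2_target_fiber : ∀ x : M, T2Space (target ⁻¹' {x})
  source_submersion : IsSmoothSubmersion (n := n) (k := k) source
  target_submersion : IsSmoothSubmersion (n := n) (k := k) target
  unit_smooth : ContMDiff (𝓡 k) (𝓡 n) ∞ unit
  source_unit : ∀ x, source (unit x) = x
  target_unit : ∀ x, target (unit x) = x
  /-- `𝒰` is a relatively open subset of the fibre product `G ×_M G`. -/
  mulDom_open : ∃ O : Set (G × G), IsOpen O ∧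
    mulDom = O ∩ {p | source p.1 = target p.2}
  unit_right_mem : ∀ g, (g, unit (source g)) ∈ mulDom
  unit_left_mem : ∀ g, (unit (target g), g) ∈ mulDom
  /-- Smoothness of the multiplication on `𝒰`, an embedded submanifold of `G × G`. -/
  mul_smooth : ContMDiffOn ((𝓡 n).prod (𝓡 n)) (𝓡 n) ∞ (fun p : G × G => mul p.1 p.2) mulDom
  /-- The multiplication is a submersion: its differential maps the tangent space
  `{(a, b) | ds a = dt b}` of `𝒰` at `(g, h)` onto the tangent space of `G` at `g h`. (On these
  vectors the derivative within `𝒰` is the differential of the multiplication.) -/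
  mul_submersion : ∀ g h : G, (g, h) ∈ mulDom → ∀ c : TangentSpace (𝓡 n) (mul g h),
    ∃ (a : TangentSpace (𝓡 n) g) (b : TangentSpace (𝓡 n) h),
      tangentMap (𝓡 n) (𝓡 k) source ⟨g, a⟩ = tangentMap (𝓡 n) (𝓡 k) target ⟨h, b⟩ ∧
      mfderivWithin ((𝓡 n).prod (𝓡 n)) (𝓡 n) (fun p : G × G => mul p.1 p.2) mulDom (g, h)
        (a, b) = c
  invDom_open : IsOpen invDom
  unit_mem_invDom : ∀ x, unit x ∈ invDom
  inv_mem_invDom : ∀ g ∈ invDom, inv g ∈ invDom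
  inv_smooth : ContMDiffOn (𝓡 n) (𝓡 n) ∞ inv invDom
  invDom_mul : ∀ g ∈ invDom, ∀ h ∈ invDom, source g = target h → (g, h) ∈ mulDom
  source_mul : ∀ g h, (g, h) ∈ mulDom → source (mul g h) = source h
  target_mul : ∀ g h, (g, h) ∈ mulDom → target (mul g h) = target g
  /-- Local associativity: near the triples with two units, both iterated products are defined
  and they agree. -/
  local_assoc : ∃ O : Set (G × G × G), IsOpen O ∧
    (∀ g, (unit (target g), unit (target g), g) ∈ O ∧
      (unit (target g), g, unit (source g)) ∈ O ∧
      (g, unit (source g), unit (source g)) ∈ O) ∧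
    ∀ g h l, (g, h, l) ∈ O → source g = target h → source h = target l →
      (g, h) ∈ mulDom ∧ (h, l) ∈ mulDom ∧ (mul g h, l) ∈ mulDom ∧ (g, mul h l) ∈ mulDom ∧
      mul (mul g h) l = mul g (mul h l)
  mul_unit : ∀ g, mul g (unit (source g)) = g
  unit_mul : ∀ g, mul (unit (target g)) g = g
  source_inv : ∀ g ∈ invDom, source (inv g) = target g
  target_inv : ∀ g ∈ invDom, target (inv g) = source g
  inv_mul : ∀ g ∈ invDom, mul (inv g) g = unit (source g)
  mul_inv : ∀ g ∈ invDom, mul g (inv g) = unit (target g)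

/-- A (global) Lie groupoid with manifold of arrows `G` and manifold of objects `M`. The product
`g h` is meaningful only for `s g = t h`. -/
structure LieGroupoid (n k : ℕ) (G : Type u) (M : Type v)
    [TopologicalSpace G] [ChartedSpace (EuclideanSpace ℝ (Fin n)) G]
    [TopologicalSpace M] [ChartedSpace (EuclideanSpace ℝ (Fin k)) M] where
  /-- the source map -/
  source : G → M
  /-- the target map -/
  target : G → M
  /-- the unit map -/
  unit : M → G
  /-- the multiplication, meaningful for composable pairs only -/
  mul : G → G → G
  /-- the inversion -/
  inv : G → G
  t2_source_fiber : ∀ x : M, T2Space (source ⁻¹' {x})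
  t2_target_fiber : ∀ x : M, T2Space (target ⁻¹' {x})
  source_submersion : IsSmoothSubmersion (n := n) (k := k) source
  target_submersion : IsSmoothSubmersion (n := n) (k := k) target
  unit_smooth : ContMDiff (𝓡 k) (𝓡 n) ∞ unit
  mul_smooth : ContMDiffOn ((𝓡 n).prod (𝓡 n)) (𝓡 n) ∞ (fun p : G × G => mul p.1 p.2)
    {p | source p.1 = target p.2}
  inv_smooth : ContMDiff (𝓡 n) (𝓡 n) ∞ inv
  source_unit : ∀ x, source (unit x) = x
  target_unit : ∀ x, target (unit x) = x
  source_mul : ∀ g h, source g = target h → source (mul g h) = source h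
  target_mul : ∀ g h, source g = target h → target (mul g h) = target g
  mul_assoc : ∀ g h l, source g = target h → source h = target l →
    mul (mul g h) l = mul g (mul h l)
  mul_unit : ∀ g, mul g (unit (source g)) = g
  unit_mul : ∀ g, mul (unit (target g)) g = g
  source_inv : ∀ g, source (inv g) = target g
  target_inv : ∀ g, target (inv g) = source g
  inv_mul : ∀ g, mul (inv g) g = unit (source g)
  mul_inv : ∀ g, mul g (inv g) = unit (target g)

namespace LocalLieGroupoid

variable {n k : ℕ} {G : Type u} {M : Type v}
  [TopologicalSpace G] [ChartedSpace (EuclideanSpace ℝ (Fin n)) G]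
  [TopologicalSpace M] [ChartedSpace (EuclideanSpace ℝ (Fin k)) M]

/-- `L.Evaluates w g`: some way of putting brackets in the word `w` gives a product all of whose
partial products are defined, and whose value is `g`. -/
inductive Evaluates (L : LocalLieGroupoid n k G M) : List G → G → Prop
  | single (g : G) : Evaluates L [g] g
  | mul {w₁ w₂ : List G} {g h : G} (hg : Evaluates L w₁ g) (hh : Evaluates L w₂ h)
      (hgh : (g, h) ∈ L.mulDom) : Evaluates L (w₁ ++ w₂) (L.mul g h)

/-- Associativity to order `N`: for `3 ≤ m ≤ N`, all defined `m`-fold products of a given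
`m`-tuple are equal. -/
def IsAssociativeToOrder (L : LocalLieGroupoid n k G M) (N : ℕ) : Prop :=
  ∀ m, 3 ≤ m → m ≤ N → ∀ w : List G, w.length = m →
    ∀ g h : G, L.Evaluates w g → L.Evaluates w h → g = h

/-- Global associativity: associativity to every order `N ≥ 3`. -/
def IsGloballyAssociative (L : LocalLieGroupoid n k G M) : Prop :=
  ∀ N, 3 ≤ N → L.IsAssociativeToOrder N

/-- Right-regularity at `g`: the differential at the unit `u (t g)` of right multiplication by `g`,
which is defined on the relatively open subset `{h | (h, g) ∈ 𝒰}` of the source fibre over `t g`,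
is an isomorphism of the tangent space of the source fibre over `t g` at `u (t g)` (the kernel
of `ds` there) onto the tangent space of the source fibre over `s g` at `u (t g) g = g`. -/
def IsRightRegularAt (L : LocalLieGroupoid n k G M) (g : G) : Prop :=
  Set.BijOn
    (mfderivWithin (𝓡 n) (𝓡 n) (fun h => L.mul h g) {h | (h, g) ∈ L.mulDom}
      (L.unit (L.target g)))
    {a | mfderiv (𝓡 n) (𝓡 k) L.source (L.unit (L.target g)) a = 0}
    {b | mfderiv (𝓡 n) (𝓡 k) L.source (L.mul (L.unit (L.target g)) g) b = 0}

/-- Left-regularity at `g`: the same for left multiplication by `g` and target fibres. -/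
def IsLeftRegularAt (L : LocalLieGroupoid n k G M) (g : G) : Prop :=
  Set.BijOn
    (mfderivWithin (𝓡 n) (𝓡 n) (fun h => L.mul g h) {h | (g, h) ∈ L.mulDom}
      (L.unit (L.source g)))
    {a | mfderiv (𝓡 n) (𝓡 k) L.target (L.unit (L.source g)) a = 0}
    {b | mfderiv (𝓡 n) (𝓡 k) L.target (L.mul g (L.unit (L.source g))) b = 0}

/-- Bi-regularity: left- and right-regularity at every arrow. -/
def IsBiregular (L : LocalLieGroupoid n k G M) : Prop :=
  ∀ g, L.IsLeftRegularAt g ∧ L.IsRightRegularAt g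

/-- Strong connectedness of a local Lie groupoid. -/
structure IsStronglyConnected (L : LocalLieGroupoid n k G M) : Prop where
  objects : ConnectedSpace M
  mulDom : IsConnected L.mulDom
  invDom : IsConnected L.invDom
  mulDom_fiber : ∀ x : M,
    IsConnected {p : G × G | p ∈ L.mulDom ∧ L.source p.1 = x ∧ L.target p.2 = x}
  source_fiber : ∀ x : M, IsConnected (L.source ⁻¹' {x})
  target_fiber : ∀ x : M, IsConnected (L.target ⁻¹' {x})
  biregular : L.IsBiregular

/-- `L` is a restriction of the open neighbourhood `U` of the units in the Lie groupoid `Γ`, where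
`Φ` is the identification of the manifold `G` with `U`: source, target and units are those
of `Γ`, and the multiplication and the inversion of `L` are obtained from those of `Γ` by
restricting them to the (possibly smaller) domains `𝒰` and `𝒱`. -/
structure IsRestrictionOf (L : LocalLieGroupoid n k G M) {A : Type u}
    [TopologicalSpace A] [ChartedSpace (EuclideanSpace ℝ (Fin n)) A]
    (Γ : LieGroupoid n k A M) (U : TopologicalSpace.Opens A) (Φ : G ≃ₘ⟮𝓡 n, 𝓡 n⟯ U) : Prop where
  unit_mem : ∀ x, Γ.unit x ∈ U
  source_eq : ∀ g, Γ.source (Φ g) = L.source g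
  target_eq : ∀ g, Γ.target (Φ g) = L.target g
  unit_eq : ∀ x, (Φ (L.unit x) : A) = Γ.unit x
  mul_eq : ∀ g h, (g, h) ∈ L.mulDom → (Φ (L.mul g h) : A) = Γ.mul (Φ g) (Φ h)
  inv_eq : ∀ g ∈ L.invDom, (Φ (L.inv g) : A) = Γ.inv (Φ g)

/-- A local Lie groupoid is globalizable if it is a restriction of an open neighbourhood of the
units in a Lie groupoid (whose manifold of arrows is second countable, like all manifolds here,
but not necessarily Hausdorff). -/
def IsGlobalizable (L : LocalLieGroupoid n k G M) : Prop :=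
  ∃ (A : Type u) (_ : TopologicalSpace A) (_ : ChartedSpace (EuclideanSpace ℝ (Fin n)) A)
    (_ : IsManifold (𝓡 n) ∞ A) (_ : SecondCountableTopology A)
    (Γ : LieGroupoid n k A M) (U : TopologicalSpace.Opens A) (Φ : G ≃ₘ⟮𝓡 n, 𝓡 n⟯ U),
    L.IsRestrictionOf Γ U Φ

end LocalLieGroupoid

/-! In a Lie groupoid the product of a composable word does not depend on the bracketing, and this
passes to every restriction; so a globalizable local groupoid is globally associative.

For the converse the global groupoid is built from words. Its elements (`Completion`) are nonempty
composable words in `G`, two words being identified when they have a common refinement: a word in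
which every letter of either one has been expanded into a word evaluating to it. Multiplication is
concatenation. If the one-letter words `[g]` and `[h]` have a common refinement, it evaluates both
to `g` and to `h`, so global associativity gives `g = h` and `G` embeds (`of_injective`).

The difficulty is that having a common refinement must be transitive. This reduces to the following:
a word `w` that evaluates to a product `c d` has a refinement that splits into a word for `c` and a
word for `d` (`IsCancellable.exists_refines`). The splitting is obtained by inserting words with
unit value at the two ends of `w`, namely a word for `c` followed by an inverse word, and the mirror
image for `d`. That such words exist (`IsCancellable`) is clear for a pair of units. By
bi-regularity, nearby pairs differ by small invertible factors, so the property is locally constant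
on the pairs in `𝒰` with fixed middle object. These form a connected set, so the property always
holds (`isCancellable`). Likewise, connectedness of source fibres makes every arrow a product of
arrows in `𝒱`, which provides inverses in the completion.

The manifold structure comes from smooth families of words (`PlotAt`). Such a family can be lifted
along a refinement of its value at one point (`Refines.exists_lift`), so one whose value at a point
is an arrow of `G` is a smooth family of arrows nearby (`PlotAt.exists_of`). Charts around `α₀`
write an element as a small arrow of `G` times a value of a local section of the source map through
`α₀`. Smoothness, openness of `G` in the completion and the Hausdorff property of the fibres then
follow from the corresponding facts about `G`. -/

section

open Topology Filter Set

/-! ### Submersions: slice charts, retractions, local sections -/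

/-- A slice chart of the map `f` at `g₀`: a smooth chart of `G` around `g₀` in which `f` is a linear
projection `P` with right inverse `J`. -/
structure SliceChart (n k : ℕ) {G : Type u} {M : Type v}
    [TopologicalSpace G] [ChartedSpace (EuclideanSpace ℝ (Fin n)) G]
    [TopologicalSpace M] [ChartedSpace (EuclideanSpace ℝ (Fin k)) M] (f : G → M) (g₀ : G) where
  θ : OpenPartialHomeomorph G (EuclideanSpace ℝ (Fin n))
  P : EuclideanSpace ℝ (Fin n) →L[ℝ] EuclideanSpace ℝ (Fin k)
  J : EuclideanSpace ℝ (Fin k) →L[ℝ] EuclideanSpace ℝ (Fin n)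
  P_J : ∀ z, P (J z) = z
  mem_source : g₀ ∈ θ.source
  smooth : ∀ g ∈ θ.source, ContMDiffAt (𝓡 n) (𝓡 n) ∞ θ g
  smooth_symm : ∀ z ∈ θ.target, ContMDiffAt (𝓡 n) (𝓡 n) ∞ θ.symm z
  maps : ∀ g ∈ θ.source, f g ∈ (chartAt (EuclideanSpace ℝ (Fin k)) (f g₀)).source
  proj : ∀ g ∈ θ.source, chartAt (EuclideanSpace ℝ (Fin k)) (f g₀) (f g) = P (θ g)

theorem contMDiffAt_chartAt {k : ℕ} {M : Type v} [TopologicalSpace M]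
    [ChartedSpace (EuclideanSpace ℝ (Fin k)) M] [IsManifold (𝓡 k) ∞ M] {a x : M}
    (hx : x ∈ (chartAt (EuclideanSpace ℝ (Fin k)) a).source) :
    ContMDiffAt (𝓡 k) (𝓡 k) ∞ (chartAt (EuclideanSpace ℝ (Fin k)) a) x :=
  contMDiffAt_of_mem_maximalAtlas (IsManifold.chart_mem_maximalAtlas a) hx

theorem contMDiffAt_chartAt_symm {k : ℕ} {M : Type v} [TopologicalSpace M]
    [ChartedSpace (EuclideanSpace ℝ (Fin k)) M] [IsManifold (𝓡 k) ∞ M] {a : M}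
    {z : EuclideanSpace ℝ (Fin k)} (hz : z ∈ (chartAt (EuclideanSpace ℝ (Fin k)) a).target) :
    ContMDiffAt (𝓡 k) (𝓡 k) ∞ (chartAt (EuclideanSpace ℝ (Fin k)) a).symm z :=
  contMDiffAt_symm_of_mem_maximalAtlas (IsManifold.chart_mem_maximalAtlas a) hz

section

variable {n k : ℕ} {G : Type u} {M : Type v}
  [TopologicalSpace G] [ChartedSpace (EuclideanSpace ℝ (Fin n)) G] [IsManifold (𝓡 n) ∞ G]
  [TopologicalSpace M] [ChartedSpace (EuclideanSpace ℝ (Fin k)) M] [IsManifold (𝓡 k) ∞ M]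

theorem IsSmoothSubmersion.nonempty_sliceChart {f : G → M}
    (hf : IsSmoothSubmersion (n := n) (k := k) f) (g₀ : G) : Nonempty (SliceChart n k f g₀) := by
  set ψ := chartAt (EuclideanSpace ℝ (Fin n)) g₀ with hψ
  set χ := chartAt (EuclideanSpace ℝ (Fin k)) (f g₀) with hχ
  have hg₀ : g₀ ∈ ψ.source := mem_chart_source _ _
  have hfg₀ : f g₀ ∈ χ.source := mem_chart_source _ _
  let W : Set (EuclideanSpace ℝ (Fin n)) := ψ.target ∩ ψ.symm ⁻¹' (f ⁻¹' χ.source)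
  have hW : IsOpen W :=
    ψ.isOpen_inter_preimage_symm (χ.open_source.preimage hf.1.continuous)
  let F : EuclideanSpace ℝ (Fin n) → EuclideanSpace ℝ (Fin k) := fun e => χ (f (ψ.symm e))
  set e₀ := ψ g₀ with he₀
  have hψe₀ : ψ.symm e₀ = g₀ := ψ.left_inv hg₀
  have he₀W : e₀ ∈ W := ⟨ψ.map_source hg₀, by simpa [hψe₀] using hfg₀⟩
  have hFm : ∀ e ∈ W, ContMDiffAt (𝓡 n) (𝓡 k) ∞ F e := fun e he =>
    (contMDiffAt_chartAt he.2).comp e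
      (hf.1.contMDiffAt.comp e (contMDiffAt_chartAt_symm he.1))
  have hF : ∀ e ∈ W, ContDiffAt ℝ ∞ F e := fun e he => (hFm e he).contDiffAt
  set P := fderiv ℝ F e₀ with hP
  have hPsurj : Function.Surjective P := by
    have h1 : HasMFDerivAt (𝓡 n) (𝓡 n) ψ.symm e₀ (mfderiv (𝓡 n) (𝓡 n) ψ.symm e₀) :=
      ((contMDiffAt_chartAt_symm he₀W.1).mdifferentiableAt (by simp)).hasMFDerivAt
    have h2 : HasMFDerivAt (𝓡 k) (𝓡 k) χ (f (ψ.symm e₀)) (mfderiv (𝓡 k) (𝓡 k) χ (f (ψ.symm e₀))) :=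
      ((contMDiffAt_chartAt he₀W.2).mdifferentiableAt (by simp)).hasMFDerivAt
    have h3 : HasMFDerivAt (𝓡 n) (𝓡 k) f (ψ.symm e₀) (mfderiv (𝓡 n) (𝓡 k) f (ψ.symm e₀)) :=
      ((hf.1.contMDiffAt (x := ψ.symm e₀)).mdifferentiableAt (by simp)).hasMFDerivAt
    have h4 := (h2.comp e₀ (h3.comp e₀ h1)).mfderiv
    have hs1 : Function.Surjective (mfderiv (𝓡 n) (𝓡 n) ψ.symm e₀) := by
      have hm := mdifferentiable_chart (I := 𝓡 n) g₀
      exact (hm.symm.mfderiv_bijective he₀W.1).2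
    have hs2 : Function.Surjective (mfderiv (𝓡 k) (𝓡 k) χ (f (ψ.symm e₀))) :=
      ((mdifferentiable_chart (I := 𝓡 k) (f g₀)).mfderiv_bijective he₀W.2).2
    have h5 : P = mfderiv (𝓡 n) (𝓡 k) F e₀ := by rw [hP, mfderiv_eq_fderiv]
    have h6 : Function.Surjective (mfderiv (𝓡 n) (𝓡 k) F e₀) := by
      rw [show mfderiv (𝓡 n) (𝓡 k) F e₀ = _ from h4]
      exact hs2.comp ((hf.2 _).comp hs1)
    rw [h5]
    exact h6
  obtain ⟨J, hJ⟩ := ContinuousLinearMap.exists_rightInverse_of_surjective P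
    (LinearMap.range_eq_top.2 hPsurj)
  have hPJ : ∀ z, P (J z) = z := fun z => by
    simpa using DFunLike.congr_fun hJ z
  -- This correction straightens `F`: from `P (J z) = z` one gets `P (T e) = F e`, and the
  -- derivative of `T` at `e₀` is the identity because `P` is the derivative of `F` there.
  let T : EuclideanSpace ℝ (Fin n) → EuclideanSpace ℝ (Fin n) := fun e => e + J (F e - P e)
  have hT : ∀ e ∈ W, ContDiffAt ℝ ∞ T e := fun e he =>
    contDiffAt_id.add (J.contDiff.contDiffAt.comp e ((hF e he).sub P.contDiff.contDiffAt))
  have hTd : HasFDerivAt T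
      ((ContinuousLinearEquiv.refl ℝ (EuclideanSpace ℝ (Fin n)) :
        EuclideanSpace ℝ (Fin n) ≃L[ℝ] EuclideanSpace ℝ (Fin n)) :
        EuclideanSpace ℝ (Fin n) →L[ℝ] EuclideanSpace ℝ (Fin n)) e₀ := by
    have h1 : HasFDerivAt F P e₀ := ((hF e₀ he₀W).differentiableAt (by simp)).hasFDerivAt
    have h2 := (hasFDerivAt_id (𝕜 := ℝ) e₀).add
      (J.hasFDerivAt.comp e₀ (h1.sub P.hasFDerivAt))
    convert! h2 using 1
    ext1 z
    simp
  let Θ := (hT e₀ he₀W).toOpenPartialHomeomorph T hTd (by simp)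
  have hΘ : ∀ e, Θ e = T e := fun _ => rfl
  -- The inverse function theorem gives smoothness of the inverse at the image of `e₀` only.
  -- Shrinking to points where the derivative of `T` is invertible gives it on the whole range of
  -- the chart.
  have hinv : ∀ᶠ e in 𝓝 e₀, ∃ A : EuclideanSpace ℝ (Fin n) ≃L[ℝ] EuclideanSpace ℝ (Fin n),
      (A : EuclideanSpace ℝ (Fin n) →L[ℝ] EuclideanSpace ℝ (Fin n)) = fderiv ℝ T e := by
    have hc : ContinuousAt (fderiv ℝ T) e₀ :=
      ((hT e₀ he₀W).fderiv_right (m := 0) (by simp)).continuousAt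
    refine hc.eventually (p := fun B => ∃ A : EuclideanSpace ℝ (Fin n) ≃L[ℝ]
      EuclideanSpace ℝ (Fin n), (A : _ →L[ℝ] EuclideanSpace ℝ (Fin n)) = B) ?_
    rw [hTd.fderiv]
    exact ContinuousLinearEquiv.nhds _
  obtain ⟨V, hV, hVo, he₀V⟩ := eventually_nhds_iff.1 hinv
  let θ := ψ.trans (Θ.restrOpen (W ∩ V) (hW.inter hVo))
  have hsrc : ∀ g ∈ θ.source, g ∈ ψ.source ∧ ψ g ∈ Θ.source ∧ ψ g ∈ W ∧ ψ g ∈ V := by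
    intro g hg
    simpa [θ, OpenPartialHomeomorph.trans_source] using hg
  refine ⟨⟨θ, P, J, hPJ, ?_, ?_, ?_, ?_, ?_⟩⟩
  · have : e₀ ∈ Θ.source := (hT e₀ he₀W).mem_toOpenPartialHomeomorph_source hTd (by simp)
    simpa [θ, OpenPartialHomeomorph.trans_source, hg₀] using ⟨this, he₀W, he₀V⟩
  · intro g hg
    obtain ⟨h1, -, h2, -⟩ := hsrc g hg
    exact (hT _ h2).contMDiffAt.comp g
      (contMDiffAt_chartAt h1)
  · intro z hz
    obtain ⟨h1, h2, h3, h4⟩ := hsrc _ (θ.map_target hz)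
    have h5 : z ∈ Θ.target ∧ Θ.symm z ∈ W ∧ Θ.symm z ∈ V ∧ Θ.symm z ∈ ψ.target := by
      simp only [θ, OpenPartialHomeomorph.trans_target, mem_inter_iff, mem_preimage] at hz
      have hz1 := hz.1
      have : z ∈ ((Θ.restrOpen (W ∩ V) (hW.inter hVo))).target := hz1
      have h6 := (Θ.restrOpen (W ∩ V) (hW.inter hVo)).map_target this
      have h7 : Θ.symm z ∈ Θ.source ∩ (W ∩ V) := h6
      refine ⟨?_, h7.2.1, h7.2.2, h7.2.1.1⟩
      have h8 := Θ.map_source h7.1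
      have h9 := (Θ.restrOpen (W ∩ V) (hW.inter hVo)).right_inv this
      have h10 : Θ (Θ.symm z) = z := h9
      rwa [h10] at h8
    obtain ⟨A, hA⟩ := hV _ h5.2.2.1
    have h6 : ContDiffAt ℝ ∞ Θ.symm z := Θ.contDiffAt_symm (f₀' := A) h5.1
      (by rw [hA]; exact ((hT _ h5.2.1).differentiableAt (by simp)).hasFDerivAt) (hT _ h5.2.1)
    exact (contMDiffAt_chartAt_symm h5.2.2.2).comp z h6.contMDiffAt
  · intro g hg
    obtain ⟨h1, -, h2, -⟩ := hsrc g hg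
    simpa [ψ.left_inv h1] using h2.2
  · intro g hg
    obtain ⟨h1, -, h2, -⟩ := hsrc g hg
    change χ (f g) = P (T (ψ g))
    simp [T, F, hPJ, ψ.left_inv h1]

end

section

variable {n k : ℕ} {G : Type u} {M : Type v}
  [TopologicalSpace G] [ChartedSpace (EuclideanSpace ℝ (Fin n)) G]
  [TopologicalSpace M] [ChartedSpace (EuclideanSpace ℝ (Fin k)) M]

namespace SliceChart

variable {f : G → M} {g₀ : G} (c : SliceChart n k f g₀)

theorem apply_symm {z : EuclideanSpace ℝ (Fin n)} (hz : z ∈ c.θ.target) {y : M}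
    (hy : y ∈ (chartAt (EuclideanSpace ℝ (Fin k)) (f g₀)).source)
    (h : c.P z = chartAt (EuclideanSpace ℝ (Fin k)) (f g₀) y) : f (c.θ.symm z) = y := by
  have h1 := c.θ.map_target hz
  refine (chartAt (EuclideanSpace ℝ (Fin k)) (f g₀)).injOn (c.maps _ h1) hy ?_
  rw [c.proj _ h1, c.θ.right_inv hz, h]

end SliceChart

variable [IsManifold (𝓡 n) ∞ G] [IsManifold (𝓡 k) ∞ M]

/-- Near `(g₀, f g₀)`, the map `ρ` moves an arrow `g` to an element of the fibre over `y`. -/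
theorem IsSmoothSubmersion.exists_retraction {f : G → M}
    (hf : IsSmoothSubmersion (n := n) (k := k) f) (g₀ : G) :
    ∃ ρ : G × M → G, ContMDiffAt ((𝓡 n).prod (𝓡 k)) (𝓡 n) ∞ ρ (g₀, f g₀) ∧
      ρ (g₀, f g₀) = g₀ ∧ (∀ᶠ p in 𝓝 (g₀, f g₀), f (ρ p) = p.2) ∧
      ∀ᶠ g in 𝓝 g₀, ρ (g, f g) = g := by
  obtain ⟨c⟩ := hf.nonempty_sliceChart g₀
  set χ := chartAt (EuclideanSpace ℝ (Fin k)) (f g₀) with hχ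
  have hfg₀ : f g₀ ∈ χ.source := mem_chart_source _ _
  let a : G × M → EuclideanSpace ℝ (Fin n) := fun p => c.θ p.1 + c.J (χ p.2 - χ (f p.1))
  have ha : ContMDiffAt ((𝓡 n).prod (𝓡 k)) (𝓡 n) ∞ a (g₀, f g₀) := by
    have h1 : ContMDiffAt ((𝓡 n).prod (𝓡 k)) (𝓡 n) ∞ (fun p : G × M => c.θ p.1) (g₀, f g₀) :=
      (c.smooth _ c.mem_source).comp _ contMDiffAt_fst
    have h2 : ContMDiffAt ((𝓡 n).prod (𝓡 k)) (𝓡 k) ∞ (fun p : G × M => χ p.2) (g₀, f g₀) :=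
      ContMDiffAt.comp (g₀, f g₀) (g := χ) (contMDiffAt_chartAt hfg₀) contMDiffAt_snd
    have h3 : ContMDiffAt ((𝓡 n).prod (𝓡 k)) (𝓡 k) ∞ (fun p : G × M => χ (f p.1)) (g₀, f g₀) :=
      ContMDiffAt.comp (g₀, f g₀) (g := χ) (f := fun p : G × M => f p.1)
        (contMDiffAt_chartAt hfg₀)
        (ContMDiffAt.comp (g₀, f g₀) (g := f) hf.1.contMDiffAt contMDiffAt_fst)
    exact h1.add (c.J.contDiff.contMDiff.contMDiffAt.comp _ (h2.sub h3))
  have ha₀ : a (g₀, f g₀) = c.θ g₀ := by simp [a]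
  have hmem : ∀ᶠ p in 𝓝 (g₀, f g₀), a p ∈ c.θ.target :=
    ha.continuousAt.eventually_mem (by
      rw [ha₀]; exact c.θ.open_target.mem_nhds (c.θ.map_source c.mem_source))
  refine ⟨fun p => c.θ.symm (a p), ?_, ?_, ?_, ?_⟩
  · refine ContMDiffAt.comp (g₀, f g₀) (g := c.θ.symm) (c.smooth_symm _ ?_) ha
    rw [ha₀]; exact c.θ.map_source c.mem_source
  · change c.θ.symm (a (g₀, f g₀)) = g₀
    rw [ha₀, c.θ.left_inv c.mem_source]
  · have h1 : ∀ᶠ p : G × M in 𝓝 (g₀, f g₀), p.2 ∈ χ.source :=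
      continuousAt_snd.eventually_mem (χ.open_source.mem_nhds hfg₀)
    have h2 : ∀ᶠ p : G × M in 𝓝 (g₀, f g₀), p.1 ∈ c.θ.source :=
      continuousAt_fst.eventually_mem (c.θ.open_source.mem_nhds c.mem_source)
    filter_upwards [hmem, h1, h2] with p hp h1 h2
    refine c.apply_symm hp h1 ?_
    simp only [a, map_add, c.P_J]
    rw [← c.proj _ h2]
    abel
  · filter_upwards [c.θ.open_source.mem_nhds c.mem_source] with g hg
    simp [a, c.θ.left_inv hg]

/-- A smooth submersion has a smooth local section through every point. -/
theorem IsSmoothSubmersion.exists_section {f : G → M}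
    (hf : IsSmoothSubmersion (n := n) (k := k) f) (g₀ : G) :
    ∃ (τ : M → G) (D : Set M), IsOpen D ∧ f g₀ ∈ D ∧ τ (f g₀) = g₀ ∧
      ∀ y ∈ D, f (τ y) = y ∧ ContMDiffAt (𝓡 k) (𝓡 n) ∞ τ y := by
  obtain ⟨c⟩ := hf.nonempty_sliceChart g₀
  set χ := chartAt (EuclideanSpace ℝ (Fin k)) (f g₀) with hχ
  have hfg₀ : f g₀ ∈ χ.source := mem_chart_source _ _
  let a : EuclideanSpace ℝ (Fin k) → EuclideanSpace ℝ (Fin n) :=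
    fun y => c.θ g₀ + c.J (y - χ (f g₀))
  have ha : ContDiff ℝ ∞ a :=
    contDiff_const.add (c.J.contDiff.comp (contDiff_id.sub contDiff_const))
  have ha₀ : a (χ (f g₀)) = c.θ g₀ := by simp [a]
  refine ⟨fun y => c.θ.symm (a (χ y)), χ.source ∩ χ ⁻¹' (a ⁻¹' c.θ.target),
    χ.isOpen_inter_preimage (c.θ.open_target.preimage ha.continuous), ⟨hfg₀, ?_⟩, ?_,
    fun y hy => ⟨?_, ?_⟩⟩
  · simpa [ha₀] using c.θ.map_source c.mem_source
  · simp [ha₀, c.θ.left_inv c.mem_source]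
  · refine c.apply_symm hy.2 hy.1 ?_
    simp only [a, map_add, c.P_J, ← c.proj _ c.mem_source]
    abel
  · exact ContMDiffAt.comp y (g := c.θ.symm) (f := fun y => a (χ y)) (c.smooth_symm _ hy.2)
      (ContMDiffAt.comp y (g := a) (f := χ) ha.contMDiff.contMDiffAt (contMDiffAt_chartAt hy.1))

end

/-- The set `D` need not be open or a neighbourhood of anything. It is applied to `𝒰`, which is only
relatively open in the fibre product: families of pairs in `𝒰` then have products that are smooth in
the unrestricted sense. -/
theorem ContMDiffOn.contMDiffAt_comp_of_eventually {𝕜 : Type*} [NontriviallyNormedField 𝕜]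
    {E₁ H₁ X E₂ H₂ Y E₃ H₃ Z : Type*}
    [NormedAddCommGroup E₁] [NormedSpace 𝕜 E₁] [TopologicalSpace H₁] [TopologicalSpace X]
    [ChartedSpace H₁ X] [NormedAddCommGroup E₂] [NormedSpace 𝕜 E₂] [TopologicalSpace H₂]
    [TopologicalSpace Y] [ChartedSpace H₂ Y] [NormedAddCommGroup E₃] [NormedSpace 𝕜 E₃]
    [TopologicalSpace H₃] [TopologicalSpace Z] [ChartedSpace H₃ Z]
    {I₁ : ModelWithCorners 𝕜 E₁ H₁} {I₂ : ModelWithCorners 𝕜 E₂ H₂}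
    {I₃ : ModelWithCorners 𝕜 E₃ H₃} {r : WithTop ℕ∞} {g : Y → Z} {D : Set Y} {f : X → Y} {x : X}
    (hg : ContMDiffOn I₂ I₃ r g D) (hf : ContMDiffAt I₁ I₂ r f x) (hD : ∀ᶠ y in 𝓝 x, f y ∈ D) :
    ContMDiffAt I₁ I₃ r (fun y => g (f y)) x :=
  (ContMDiffWithinAt.comp (s := f ⁻¹' D) x (hg (f x) hD.self_of_nhds) hf.contMDiffWithinAt
    (fun _ h => h)).contMDiffAt hD

/-! ### Division by arrows, from the inverse function theorem -/

section

variable {n k : ℕ} {G : Type u} {M : Type v}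
  [TopologicalSpace G] [ChartedSpace (EuclideanSpace ℝ (Fin n)) G]
  [TopologicalSpace M] [ChartedSpace (EuclideanSpace ℝ (Fin k)) M]
  [IsManifold (𝓡 n) ∞ G] [IsManifold (𝓡 k) ∞ M]

/-- Division by arrows near `c₀`, for a partial action `m` of arrows near `u₀` whose differential
at `u₀` along the fibre of `s` is injective. -/
theorem exists_division {s t : G → M} (hs : IsSmoothSubmersion (n := n) (k := k) s)
    (ht : ContMDiff (𝓡 n) (𝓡 k) ∞ t) {m : G → G → G} {O D : Set (G × G)} (hO : IsOpen O)
    (hD : D = O ∩ {p | s p.1 = t p.2})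
    (hm : ContMDiffOn ((𝓡 n).prod (𝓡 n)) (𝓡 n) ∞ (fun p : G × G => m p.1 p.2) D)
    (hsm : ∀ p ∈ D, s (m p.1 p.2) = s p.2) {u₀ c₀ : G} (hu : (u₀, c₀) ∈ D) (hmu : m u₀ c₀ = c₀)
    (hinj : Set.InjOn
      (mfderivWithin (𝓡 n) (𝓡 n) (fun h => m h c₀) {h | (h, c₀) ∈ D} u₀)
      {a | mfderiv (𝓡 n) (𝓡 k) s u₀ a = 0}) :
    ∃ δ : G × G → G, ContMDiffAt ((𝓡 n).prod (𝓡 n)) (𝓡 n) ∞ δ (c₀, c₀) ∧ δ (c₀, c₀) = u₀ ∧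
      ∀ᶠ p in 𝓝 (c₀, c₀), s p.1 = s p.2 → (δ p, p.2) ∈ D ∧ m (δ p) p.2 = p.1 := by
  obtain ⟨c⟩ := hs.nonempty_sliceChart u₀
  obtain ⟨c'⟩ := hs.nonempty_sliceChart c₀
  have hst : s u₀ = t c₀ := by rw [hD] at hu; exact hu.2
  set χ := chartAt (EuclideanSpace ℝ (Fin k)) (s u₀) with hχ
  have hsu : s u₀ ∈ χ.source := mem_chart_source _ _
  set z₀ := c.θ u₀ with hz₀
  set e₀ := c'.θ c₀ with he₀
  have he₀c : c'.θ.symm e₀ = c₀ := c'.θ.left_inv c'.mem_source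
  have he₀t : e₀ ∈ c'.θ.target := c'.θ.map_source c'.mem_source
  -- the arrow near `u₀` over `t c` with given fibre coordinate
  let a : EuclideanSpace ℝ (Fin n) × G → EuclideanSpace ℝ (Fin n) :=
    fun q => c.J (χ (t q.2)) + (q.1 - c.J (c.P q.1))
  let v : EuclideanSpace ℝ (Fin n) × G → G := fun q => c.θ.symm (a q)
  have ha₀ : a (z₀, c₀) = z₀ := by
    simp only [a, ← hst, hz₀]
    rw [← c.proj _ c.mem_source]
    abel
  have ha : ContMDiffAt ((𝓡 n).prod (𝓡 n)) (𝓡 n) ∞ a (z₀, c₀) := by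
    have h1 : ContMDiffAt ((𝓡 n).prod (𝓡 n)) (𝓡 k) ∞
        (fun q : EuclideanSpace ℝ (Fin n) × G => χ (t q.2)) (z₀, c₀) :=
      ContMDiffAt.comp (z₀, c₀) (g := χ) (f := fun q : EuclideanSpace ℝ (Fin n) × G => t q.2)
        (contMDiffAt_chartAt (by rw [← hst]; exact hsu))
        (ContMDiffAt.comp (z₀, c₀) (g := t) ht.contMDiffAt contMDiffAt_snd)
    have h2 : ContDiff ℝ ∞ (fun z : EuclideanSpace ℝ (Fin n) => z - c.J (c.P z)) :=
      contDiff_id.sub (c.J.contDiff.comp c.P.contDiff)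
    exact (c.J.contDiff.contMDiff.contMDiffAt.comp _ h1).add
      (h2.contMDiff.contMDiffAt.comp (z₀, c₀) contMDiffAt_fst)
  have hv : ContMDiffAt ((𝓡 n).prod (𝓡 n)) (𝓡 n) ∞ v (z₀, c₀) :=
    ContMDiffAt.comp (z₀, c₀) (g := c.θ.symm)
      (c.smooth_symm _ (by rw [ha₀]; exact c.θ.map_source c.mem_source)) ha
  have hv₀ : v (z₀, c₀) = u₀ := by
    simp only [v, ha₀]; exact c.θ.left_inv c.mem_source
  have hat : ∀ᶠ q in 𝓝 (z₀, c₀), a q ∈ c.θ.target :=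
    ha.continuousAt.eventually_mem (by
      rw [ha₀]; exact c.θ.open_target.mem_nhds (c.θ.map_source c.mem_source))
  have hsv : ∀ᶠ q in 𝓝 (z₀, c₀), s (v q) = t q.2 := by
    have h1 : ∀ᶠ q : EuclideanSpace ℝ (Fin n) × G in 𝓝 (z₀, c₀), t q.2 ∈ χ.source :=
      (ht.continuous.comp continuous_snd).continuousAt.eventually_mem
        (χ.open_source.mem_nhds (by simpa [← hst] using hsu))
    filter_upwards [hat, h1] with q hq h1
    refine c.apply_symm hq h1 ?_
    simp [a, c.P_J, hχ]
  have hvD : ∀ᶠ q in 𝓝 (z₀, c₀), (v q, q.2) ∈ D := by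
    have h1 : ContinuousAt (fun q => (v q, q.2)) (z₀, c₀) :=
      hv.continuousAt.prodMk continuousAt_snd
    have h2 : ∀ᶠ q in 𝓝 (z₀, c₀), (v q, q.2) ∈ O :=
      h1.eventually_mem (by
        rw [hv₀]; rw [hD] at hu; exact hO.mem_nhds hu.1)
    filter_upwards [hsv, h2] with q h3 h4
    rw [hD]; exact ⟨h4, h3⟩
  let w : EuclideanSpace ℝ (Fin n) × G → G := fun q => m (v q) q.2
  have hw₀ : w (z₀, c₀) = c₀ := by simp [w, hv₀, hmu]
  have hw : ContMDiffAt ((𝓡 n).prod (𝓡 n)) (𝓡 n) ∞ w (z₀, c₀) :=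
    hm.contMDiffAt_comp_of_eventually (f := fun q => (v q, q.2))
      (hv.prodMk contMDiffAt_snd) hvD
  have hwsrc : ∀ᶠ q in 𝓝 (z₀, c₀), w q ∈ c'.θ.source :=
    hw.continuousAt.eventually_mem (by
      rw [hw₀]; exact c'.θ.open_source.mem_nhds c'.mem_source)
  -- the equation to be solved
  let H : EuclideanSpace ℝ (Fin n) × EuclideanSpace ℝ (Fin n) → EuclideanSpace ℝ (Fin n) :=
    fun q => c'.θ (w (q.1, c'.θ.symm q.2)) - c'.J (c'.P (c'.θ (w (q.1, c'.θ.symm q.2))))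
      + c'.J (c.P q.1)
  let ι : EuclideanSpace ℝ (Fin n) × EuclideanSpace ℝ (Fin n) → EuclideanSpace ℝ (Fin n) × G :=
    fun q => (q.1, c'.θ.symm q.2)
  have hι₀ : ι (z₀, e₀) = (z₀, c₀) := by simp [ι, he₀c]
  have hι : ContMDiffAt 𝓘(ℝ, EuclideanSpace ℝ (Fin n) × EuclideanSpace ℝ (Fin n))
      ((𝓡 n).prod (𝓡 n)) ∞ ι (z₀, e₀) :=
    contDiff_fst.contMDiff.contMDiffAt.prodMk
      (ContMDiffAt.comp (z₀, e₀) (g := c'.θ.symm) (c'.smooth_symm _ he₀t)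
        contDiff_snd.contMDiff.contMDiffAt)
  have hW : ContDiffAt ℝ ∞ (fun q => c'.θ (w (ι q))) (z₀, e₀) := by
    have h1 : ContMDiffAt 𝓘(ℝ, EuclideanSpace ℝ (Fin n) × EuclideanSpace ℝ (Fin n))
        (𝓡 n) ∞ (fun q => w (ι q)) (z₀, e₀) :=
      ContMDiffAt.comp (z₀, e₀) (g := w) (f := ι) (by rw [hι₀]; exact hw) hι
    exact (ContMDiffAt.comp (z₀, e₀) (g := c'.θ) (f := fun q => w (ι q))
      (c'.smooth _ (by rw [hι₀, hw₀]; exact c'.mem_source)) h1).contDiffAt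
  have hH : ContDiffAt ℝ ∞ H (z₀, e₀) :=
    (hW.sub ((c'.J.comp c'.P).contDiff.contDiffAt.comp _ hW)).add
      ((c'.J.comp c.P).contDiff.contDiffAt.comp _ contDiffAt_fst)
  -- The unknown `q.1` enters the product only through its fibre coordinate `q.1 - J (P q.1)`, and
  -- the source of the product is prescribed. The redundant component `P q.1` is therefore carried
  -- along in `H` in place of the base coordinate of the product, which makes the system square.
  -- Keeping the parameter `q.2` reduces the implicit function theorem to the inverse one.
  let K : EuclideanSpace ℝ (Fin n) × EuclideanSpace ℝ (Fin n) →
    EuclideanSpace ℝ (Fin n) × EuclideanSpace ℝ (Fin n) := fun q => (H q, q.2)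
  have hK : ContDiffAt ℝ ∞ K (z₀, e₀) := hH.prodMk contDiffAt_snd
  -- For a kernel vector `(x, y)` the second component gives `y = 0`. Applying `c'.P` to the first
  -- gives `c.P x = 0`, so the product has no velocity along the fibre; it has none along the base
  -- either, since `hsm` fixes its source. By `hinj` the velocity of the small arrow vanishes too,
  -- and in the slice chart that velocity is `x - J (P x) = x`.
  have hKinj : Function.Injective (fderiv ℝ K (z₀, e₀)) := by
    rw [injective_iff_map_eq_zero]
    rintro ⟨x, y⟩ hxy
    rw [((hH.differentiableAt (by simp)).hasFDerivAt.prodMk hasFDerivAt_snd).fderiv] at hxy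
    obtain rfl : y = 0 := congrArg Prod.snd hxy
    have hHx : fderiv ℝ H (z₀, e₀) (x, 0) = 0 := congrArg Prod.fst hxy
    have hincl : Tendsto (fun z : EuclideanSpace ℝ (Fin n) => (z, c₀)) (𝓝 z₀) (𝓝 (z₀, c₀)) :=
      (Continuous.prodMk_left c₀).tendsto z₀
    have hinclm : ContMDiffAt (𝓡 n) ((𝓡 n).prod (𝓡 n)) ∞
        (fun z : EuclideanSpace ℝ (Fin n) => (z, c₀)) z₀ := contMDiffAt_id.prodMk contMDiffAt_const
    let f : EuclideanSpace ℝ (Fin n) → G := fun z => w (z, c₀)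
    let ζ : EuclideanSpace ℝ (Fin n) → G := fun z => v (z, c₀)
    have hf : MDifferentiableAt (𝓡 n) (𝓡 n) f z₀ :=
      (ContMDiffAt.comp z₀ (g := w) hw hinclm).mdifferentiableAt (by simp)
    have hζ : MDifferentiableAt (𝓡 n) (𝓡 n) ζ z₀ :=
      (ContMDiffAt.comp z₀ (g := v) hv hinclm).mdifferentiableAt (by simp)
    have hf₀ : f z₀ = c₀ := hw₀
    have hζ₀ : ζ z₀ = u₀ := hv₀
    have hWx : fderiv ℝ (fun z => c'.θ (f z)) z₀ x = 0 ∧ c.P x = 0 := by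
      have hW1 : HasFDerivAt (fun z => c'.θ (f z)) (fderiv ℝ (fun z => c'.θ (f z)) z₀) z₀ := by
        have h1 : ContMDiffAt (𝓡 n) (𝓡 n) ∞ (fun z => c'.θ (f z)) z₀ :=
          ContMDiffAt.comp z₀ (g := c'.θ) (f := f)
            (c'.smooth _ (by rw [hf₀]; exact c'.mem_source))
            (ContMDiffAt.comp z₀ (g := w) hw hinclm)
        exact (h1.contDiffAt.differentiableAt (by simp)).hasFDerivAt
      have h1 := (hW1.sub ((c'.J.comp c'.P).hasFDerivAt.comp z₀ hW1)).add
        ((c'.J.comp c.P).hasFDerivAt (x := z₀))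
      have h2 : HasFDerivAt (fun z => H (z, e₀)) _ z₀ :=
        HasFDerivAt.comp z₀ (g := H) (f := fun z => (z, e₀))
          (hH.differentiableAt (by simp)).hasFDerivAt (hasFDerivAt_prodMk_left z₀ e₀)
      have h3 : (fun z => H (z, e₀)) = fun z => c'.θ (f z) - (c'.J.comp c'.P) (c'.θ (f z))
          + (c'.J.comp c.P) z := by
        funext z
        simp only [H, he₀c]
        rfl
      rw [h3] at h2
      have h4 := DFunLike.congr_fun (h2.unique h1) x
      have h5 : fderiv ℝ H (z₀, e₀) (x, 0) = fderiv ℝ (fun z => c'.θ (f z)) z₀ x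
          - c'.J (c'.P (fderiv ℝ (fun z => c'.θ (f z)) z₀ x)) + c'.J (c.P x) := by
        simpa using h4
      rw [hHx] at h5
      have h6 := congrArg c'.P h5
      simp only [map_zero, map_add, map_sub, c'.P_J, sub_self, zero_add] at h6
      have h7 : c'.P (fderiv ℝ (fun z => c'.θ (f z)) z₀ x) = 0 := by
        have h8 := c'.P.hasFDerivAt.comp z₀ hW1
        have h9 : (c'.P ∘ fun z => c'.θ (f z)) =ᶠ[𝓝 z₀]
            fun _ => chartAt (EuclideanSpace ℝ (Fin k)) (s c₀) (s c₀) := by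
          filter_upwards [hincl.eventually hvD, hincl.eventually hwsrc] with z h10 h11
          change c'.P (c'.θ (w (z, c₀))) = _
          rw [← c'.proj _ h11]
          exact congrArg _ (hsm _ h10)
        have h10 := h8.unique ((hasFDerivAt_const _ z₀).congr_of_eventuallyEq h9)
        exact DFunLike.congr_fun h10 x
      rw [h7, ← h6] at h5
      exact ⟨by simpa using h5.symm, h6.symm⟩
    obtain ⟨hWx, hPx⟩ := hWx
    have hfx : mfderiv (𝓡 n) (𝓡 n) f z₀ x = 0 := by
      have h1 : HasMFDerivAt (𝓡 n) (𝓡 n) c'.θ.symm (c'.θ (f z₀))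
          (mfderiv (𝓡 n) (𝓡 n) c'.θ.symm (c'.θ (f z₀))) :=
        ((c'.smooth_symm _ (by rw [hf₀]; exact he₀t)).mdifferentiableAt (by simp)).hasMFDerivAt
      have h0 : MDifferentiableAt (𝓡 n) (𝓡 n) (fun z => c'.θ (f z)) z₀ :=
        ((c'.smooth (f z₀) (by rw [hf₀]; exact c'.mem_source)).mdifferentiableAt
          (by simp)).comp z₀ hf
      have h2 := h1.comp z₀ h0.hasMFDerivAt
      have h3 : f =ᶠ[𝓝 z₀] c'.θ.symm ∘ fun z => c'.θ (f z) := by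
        filter_upwards [hincl.eventually hwsrc] with z hz
        exact (c'.θ.left_inv hz).symm
      have h4 := (h2.congr_of_eventuallyEq h3).mfderiv
      rw [mfderiv_eq_fderiv] at h4
      rw [h4]
      change (mfderiv (𝓡 n) (𝓡 n) c'.θ.symm (c'.θ (f z₀)))
        (fderiv ℝ (fun z => c'.θ (f z)) z₀ x) = 0
      rw [hWx]
      exact (mfderiv (𝓡 n) (𝓡 n) c'.θ.symm (c'.θ (f z₀))).map_zero
    have hζx : mfderiv (𝓡 n) (𝓡 n) ζ z₀ x = 0 := by
      have hmd : MDifferentiableWithinAt (𝓡 n) (𝓡 n) (fun h => m h c₀) {h | (h, c₀) ∈ D} (ζ z₀) := by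
        rw [hζ₀]
        exact ((hm (u₀, c₀) hu).comp (g := fun p : G × G => m p.1 p.2) (f := fun h => (h, c₀)) u₀
          (contMDiffAt_id.prodMk contMDiffAt_const).contMDiffWithinAt
          (fun _ h => h)).mdifferentiableWithinAt (by simp)
      have hζD : ζ ⁻¹' {h | (h, c₀) ∈ D} ∈ 𝓝 z₀ := hincl.eventually hvD
      have h1 : HasMFDerivAt (𝓡 n) (𝓡 n) f z₀ _ :=
        (HasMFDerivWithinAt.comp z₀ hmd.hasMFDerivWithinAt
          hζ.hasMFDerivAt.hasMFDerivWithinAt (subset_refl _)).hasMFDerivAt hζD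
      have h2 : mfderivWithin (𝓡 n) (𝓡 n) (fun h => m h c₀) {h | (h, c₀) ∈ D} (ζ z₀)
          (mfderiv (𝓡 n) (𝓡 n) ζ z₀ x) = 0 := by
        have := h1.mfderiv
        rw [this] at hfx
        exact hfx
      have h3 : mfderiv (𝓡 n) (𝓡 k) s (ζ z₀) (mfderiv (𝓡 n) (𝓡 n) ζ z₀ x) = 0 := by
        have h4 := (hs.1.contMDiffAt.mdifferentiableAt (by simp)).hasMFDerivAt.comp z₀
          hζ.hasMFDerivAt
        have h5 : s ∘ ζ =ᶠ[𝓝 z₀] fun _ => t c₀ := hincl.eventually hsv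
        have h6 := (h4.congr_of_eventuallyEq h5.symm).mfderiv
        rw [mfderiv_const] at h6
        exact (DFunLike.congr_fun h6 x).symm
      rw [hζ₀] at h2 h3
      exact hinj h3 (show (0 : TangentSpace (𝓡 n) u₀) ∈ _ from map_zero _)
        (h2.trans (map_zero _).symm)
    have h1 : HasMFDerivAt (𝓡 n) (𝓡 n) (c.θ ∘ ζ) z₀ _ :=
      ((c.smooth (ζ z₀) (by rw [hζ₀]; exact c.mem_source)).mdifferentiableAt
        (by simp)).hasMFDerivAt.comp z₀ hζ.hasMFDerivAt
    have h2 : c.θ ∘ ζ =ᶠ[𝓝 z₀] fun z => c.J (χ (t c₀)) + (z - c.J (c.P z)) := by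
      filter_upwards [hincl.eventually hat] with z hz
      exact c.θ.right_inv hz
    have h3 : HasFDerivAt (fun z => c.J (χ (t c₀)) + (z - c.J (c.P z)))
        (ContinuousLinearMap.id ℝ _ - c.J.comp c.P) z₀ :=
      ((hasFDerivAt_id z₀).sub (c.J.comp c.P).hasFDerivAt).const_add _
    have h4 := (h1.congr_of_eventuallyEq h2.symm).mfderiv
    rw [mfderiv_eq_fderiv, h3.fderiv] at h4
    have h5 : x - c.J (c.P x) = mfderiv (𝓡 n) (𝓡 n) c.θ (ζ z₀) (mfderiv (𝓡 n) (𝓡 n) ζ z₀ x) :=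
      DFunLike.congr_fun h4 x
    rw [hζx, hPx, map_zero, sub_zero] at h5
    rw [h5]
    exact congrArg (fun y => (y, (0 : EuclideanSpace ℝ (Fin n))))
      (mfderiv (𝓡 n) (𝓡 n) c.θ (ζ z₀)).map_zero
  obtain ⟨A, hA⟩ : ∃ A : (EuclideanSpace ℝ (Fin n) × EuclideanSpace ℝ (Fin n)) ≃L[ℝ]
      (EuclideanSpace ℝ (Fin n) × EuclideanSpace ℝ (Fin n)), (A : _ →L[ℝ] _) =
      fderiv ℝ K (z₀, e₀) :=
    ⟨(LinearEquiv.ofInjectiveEndo (fderiv ℝ K (z₀, e₀) : _ →ₗ[ℝ] _)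
      hKinj).toContinuousLinearEquiv, ContinuousLinearMap.ext fun _ => rfl⟩
  have hKd : HasFDerivAt K (A : _ →L[ℝ] _) (z₀, e₀) := by
    rw [hA]; exact (hK.differentiableAt (by simp)).hasFDerivAt
  have hK₀ : K (z₀, e₀) = (e₀ - c'.J (c'.P e₀) + c'.J (c.P z₀), e₀) := by
    change (c'.θ (w (z₀, c'.θ.symm e₀)) - c'.J (c'.P (c'.θ (w (z₀, c'.θ.symm e₀))))
      + c'.J (c.P z₀), e₀) = _
    rw [he₀c, hw₀]
  let Λ := hK.localInverse hKd (by simp)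
  have hΛ : ContDiffAt ℝ ∞ Λ (K (z₀, e₀)) := hK.to_localInverse hKd (by simp)
  have hΛ₀ : Λ (K (z₀, e₀)) = (z₀, e₀) := hK.localInverse_apply_image hKd (by simp)
  have hKΛ : ∀ᶠ q in 𝓝 (K (z₀, e₀)), K (Λ q) = q :=
    (hK.hasStrictFDerivAt' hKd (by simp)).eventually_right_inverse
  -- The right-hand side prescribes the fibre coordinate of `p.1` and the value `c.P z₀` for the
  -- redundant component. The base coordinates of the product and of `p.1` agree as soon as `s p.1 =
  -- s p.2`.
  let κ : G × G → EuclideanSpace ℝ (Fin n) × EuclideanSpace ℝ (Fin n) := fun p =>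
    (c'.θ p.1 - c'.J (c'.P (c'.θ p.1)) + c'.J (c.P z₀), c'.θ p.2)
  have hκ₀ : κ (c₀, c₀) = K (z₀, e₀) := by rw [hK₀]
  have hκ : ContMDiffAt ((𝓡 n).prod (𝓡 n))
      𝓘(ℝ, EuclideanSpace ℝ (Fin n) × EuclideanSpace ℝ (Fin n)) ∞ κ (c₀, c₀) := by
    have h1 : ContMDiffAt ((𝓡 n).prod (𝓡 n)) (𝓡 n) ∞ (fun p : G × G => c'.θ p.1) (c₀, c₀) :=
      ContMDiffAt.comp (c₀, c₀) (g := c'.θ) (c'.smooth _ c'.mem_source) contMDiffAt_fst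
    have h2 : ContMDiffAt ((𝓡 n).prod (𝓡 n)) (𝓡 n) ∞ (fun p : G × G => c'.θ p.2) (c₀, c₀) :=
      ContMDiffAt.comp (c₀, c₀) (g := c'.θ) (c'.smooth _ c'.mem_source) contMDiffAt_snd
    have h3 : ContDiff ℝ ∞ (fun q : EuclideanSpace ℝ (Fin n) =>
        q - c'.J (c'.P q) + c'.J (c.P z₀)) :=
      (contDiff_id.sub (c'.J.contDiff.comp c'.P.contDiff)).add contDiff_const
    exact (h3.contMDiff.contMDiffAt.comp (c₀, c₀) h1).prodMk_space h2
  have hΛκ : ContMDiffAt ((𝓡 n).prod (𝓡 n))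
      𝓘(ℝ, EuclideanSpace ℝ (Fin n) × EuclideanSpace ℝ (Fin n)) ∞ (fun p => Λ (κ p)) (c₀, c₀) :=
    ContMDiffAt.comp (c₀, c₀) (g := Λ) (by rw [hκ₀]; exact hΛ.contMDiffAt) hκ
  have hZ : ContMDiffAt ((𝓡 n).prod (𝓡 n)) (𝓡 n) ∞ (fun p => (Λ (κ p)).1) (c₀, c₀) :=
    ContMDiffAt.comp (c₀, c₀) (g := Prod.fst) (f := fun p => Λ (κ p))
      (contDiff_fst.contMDiff.contMDiffAt) hΛκ
  have hZ₀ : ((Λ (κ (c₀, c₀))).1, c₀) = (z₀, c₀) := by rw [hκ₀, hΛ₀]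
  have hZp : ContMDiffAt ((𝓡 n).prod (𝓡 n)) ((𝓡 n).prod (𝓡 n)) ∞
      (fun p : G × G => ((Λ (κ p)).1, p.2)) (c₀, c₀) := hZ.prodMk contMDiffAt_snd
  have hZt : Tendsto (fun p : G × G => ((Λ (κ p)).1, p.2)) (𝓝 (c₀, c₀)) (𝓝 (z₀, c₀)) := by
    have := hZp.continuousAt.tendsto
    rwa [hZ₀] at this
  refine ⟨fun p => v ((Λ (κ p)).1, p.2), ?_, ?_, ?_⟩
  · exact ContMDiffAt.comp (c₀, c₀) (g := v) (f := fun p : G × G => ((Λ (κ p)).1, p.2))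
      (by rw [hZ₀]; exact hv) hZp
  · change v ((Λ (κ (c₀, c₀))).1, c₀) = u₀
    rw [hZ₀, hv₀]
  · have h1 : ∀ᶠ p in 𝓝 (c₀, c₀), K (Λ (κ p)) = κ p :=
      (by rw [← hκ₀] at hKΛ; exact hκ.continuousAt.eventually hKΛ)
    have h4 : ∀ᶠ p : G × G in 𝓝 (c₀, c₀), p.1 ∈ c'.θ.source :=
      continuousAt_fst.eventually_mem (c'.θ.open_source.mem_nhds c'.mem_source)
    have h5 : ∀ᶠ p : G × G in 𝓝 (c₀, c₀), p.2 ∈ c'.θ.source :=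
      continuousAt_snd.eventually_mem (c'.θ.open_source.mem_nhds c'.mem_source)
    filter_upwards [h1, hZt.eventually hvD, hZt.eventually hwsrc, h4, h5] with p h1 h2 h3 h4 h5 h6
    refine ⟨h2, ?_⟩
    have h7 : (Λ (κ p)).2 = c'.θ p.2 := congrArg Prod.snd h1
    have h8 : H (Λ (κ p)) = (κ p).1 := congrArg Prod.fst h1
    simp only [H, h7, c'.θ.left_inv h5, κ] at h8
    have h9 := congrArg c'.P h8
    simp only [map_add, map_sub, c'.P_J, sub_self, zero_add] at h9
    rw [h9, add_left_inj] at h8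
    refine c'.θ.injOn h3 h4 ?_
    have h10 : c'.P (c'.θ (w ((Λ (κ p)).1, p.2))) = c'.P (c'.θ p.1) := by
      rw [← c'.proj _ h3, ← c'.proj _ h4, h6]
      exact congrArg _ (hsm _ h2)
    rw [h10] at h8
    exact sub_left_injective h8

end

namespace LocalLieGroupoid

/-! ### Local continuity, cancellation and division in a local Lie groupoid -/

section Basic

variable {n k : ℕ} {G : Type u} {M : Type v}
  [TopologicalSpace G] [ChartedSpace (EuclideanSpace ℝ (Fin n)) G]
  [TopologicalSpace M] [ChartedSpace (EuclideanSpace ℝ (Fin k)) M]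
  {L : LocalLieGroupoid n k G M}

theorem source_eq_target_of_mem {g h : G} (hgh : (g, h) ∈ L.mulDom) :
    L.source g = L.target h := by
  obtain ⟨O, -, hO⟩ := L.mulDom_open
  rw [hO] at hgh
  exact hgh.2

/-- Relative openness of `𝒰` in the form in which it is used: near a pair in `𝒰`, only composability
has to be checked. -/
theorem eventually_mem_mulDom {X : Type*} {l : Filter X} {f g : X → G} {a b : G}
    (hf : Tendsto f l (𝓝 a)) (hg : Tendsto g l (𝓝 b)) (hab : (a, b) ∈ L.mulDom)
    (hfg : ∀ᶠ x in l, L.source (f x) = L.target (g x)) : ∀ᶠ x in l, (f x, g x) ∈ L.mulDom := by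
  obtain ⟨O, hO, hU⟩ := L.mulDom_open
  rw [hU] at hab ⊢
  filter_upwards [(hf.prodMk_nhds hg).eventually_mem (hO.mem_nhds hab.1), hfg] with x h1 h2
  exact ⟨h1, h2⟩

theorem tendsto_mul {X : Type*} {l : Filter X} {f g : X → G} {a b : G}
    (hf : Tendsto f l (𝓝 a)) (hg : Tendsto g l (𝓝 b)) (hab : (a, b) ∈ L.mulDom)
    (hfg : ∀ᶠ x in l, (f x, g x) ∈ L.mulDom) :
    Tendsto (fun x => L.mul (f x) (g x)) l (𝓝 (L.mul a b)) :=
  (L.mul_smooth.continuousOn (a, b) hab).tendsto.comp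
    (tendsto_nhdsWithin_iff.2 ⟨hf.prodMk_nhds hg, hfg⟩)

theorem inv_unit (x : M) : L.inv (L.unit x) = L.unit x := by
  have h1 := L.unit_mem_invDom x
  have h2 := L.mul_unit (L.inv (L.unit x))
  rw [L.source_inv _ h1, L.target_unit] at h2
  rw [← h2, L.inv_mul _ h1, L.source_unit]

theorem inv_mem_mulDom {g : G} (hg : g ∈ L.invDom) : (L.inv g, g) ∈ L.mulDom :=
  L.invDom_mul _ (L.inv_mem_invDom g hg) _ hg (L.source_inv g hg)

theorem mem_mulDom_inv {g : G} (hg : g ∈ L.invDom) : (g, L.inv g) ∈ L.mulDom :=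
  L.invDom_mul _ hg _ (L.inv_mem_invDom g hg) (L.target_inv g hg).symm

theorem tendsto_inv_unit (x : M) : Tendsto L.inv (𝓝 (L.unit x)) (𝓝 (L.unit x)) := by
  have h := (L.inv_smooth.continuousOn.continuousAt
    (L.invDom_open.mem_nhds (L.unit_mem_invDom x))).tendsto
  rwa [inv_unit] at h

/-- Local associativity at the triple `(u, u, g₀)`, applied to `(i v, v, g)` with `v` so close to
the unit that it lies in `𝒱`. -/
theorem eventually_inv_mul_cancel (g₀ : G) : ∀ᶠ p : G × G in 𝓝 (L.unit (L.target g₀), g₀),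
    L.source p.1 = L.target p.2 → p.1 ∈ L.invDom ∧ (p.1, p.2) ∈ L.mulDom ∧
      (L.inv p.1, L.mul p.1 p.2) ∈ L.mulDom ∧ L.mul (L.inv p.1) (L.mul p.1 p.2) = p.2 := by
  obtain ⟨O, hO, hmem, hassoc⟩ := L.local_assoc
  have h1 : Tendsto (fun p : G × G => (L.inv p.1, p.1, p.2)) (𝓝 (L.unit (L.target g₀), g₀))
      (𝓝 (L.unit (L.target g₀), L.unit (L.target g₀), g₀)) :=
    ((tendsto_inv_unit _).comp continuousAt_fst.tendsto).prodMk_nhds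
      (continuousAt_fst.tendsto.prodMk_nhds continuousAt_snd.tendsto)
  have h2 : ∀ᶠ p : G × G in 𝓝 (L.unit (L.target g₀), g₀), p.1 ∈ L.invDom :=
    continuousAt_fst.eventually_mem (L.invDom_open.mem_nhds (L.unit_mem_invDom _))
  filter_upwards [h1.eventually_mem (hO.mem_nhds (hmem g₀).1), h2] with p h3 h4 h5
  obtain ⟨-, h6, -, h8, h9⟩ := hassoc _ _ _ h3 (L.source_inv _ h4) h5
  refine ⟨h4, h6, h8, ?_⟩
  rw [← h9, L.inv_mul _ h4, h5, L.unit_mul]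

theorem eventually_mul_inv_cancel (g₀ : G) : ∀ᶠ p : G × G in 𝓝 (g₀, L.unit (L.source g₀)),
    L.source p.1 = L.target p.2 → p.2 ∈ L.invDom ∧ (p.1, p.2) ∈ L.mulDom ∧
      (L.mul p.1 p.2, L.inv p.2) ∈ L.mulDom ∧ L.mul (L.mul p.1 p.2) (L.inv p.2) = p.1 := by
  obtain ⟨O, hO, hmem, hassoc⟩ := L.local_assoc
  have h1 : Tendsto (fun p : G × G => (p.1, p.2, L.inv p.2)) (𝓝 (g₀, L.unit (L.source g₀)))
      (𝓝 (g₀, L.unit (L.source g₀), L.unit (L.source g₀))) :=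
    continuousAt_fst.tendsto.prodMk_nhds
      (continuousAt_snd.tendsto.prodMk_nhds ((tendsto_inv_unit _).comp continuousAt_snd.tendsto))
  have h2 : ∀ᶠ p : G × G in 𝓝 (g₀, L.unit (L.source g₀)), p.2 ∈ L.invDom :=
    continuousAt_snd.eventually_mem (L.invDom_open.mem_nhds (L.unit_mem_invDom _))
  filter_upwards [h1.eventually_mem (hO.mem_nhds (hmem g₀).2.2), h2] with p h3 h4 h5
  obtain ⟨h6, -, h7, -, h9⟩ := hassoc _ _ _ h3 h5 (L.target_inv _ h4).symm
  refine ⟨h4, h6, h7, ?_⟩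
  rw [h9, L.mul_inv _ h4, ← h5, L.mul_unit]

variable [IsManifold (𝓡 n) ∞ G] [IsManifold (𝓡 k) ∞ M]

/-- Right division: an arrow `h` near `c₀` is the product of a small arrow and any arrow near `c₀`
with the same source. -/
theorem exists_right_division {c₀ : G} (hr : L.IsRightRegularAt c₀) :
    ∃ δ : G × G → G, ContMDiffAt ((𝓡 n).prod (𝓡 n)) (𝓡 n) ∞ δ (c₀, c₀) ∧
      δ (c₀, c₀) = L.unit (L.target c₀) ∧
      ∀ᶠ p in 𝓝 (c₀, c₀), L.source p.1 = L.source p.2 →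
        (δ p, p.2) ∈ L.mulDom ∧ L.mul (δ p) p.2 = p.1 := by
  obtain ⟨O, hO, hU⟩ := L.mulDom_open
  exact exists_division L.source_submersion L.target_submersion.1 hO hU L.mul_smooth
    (fun p hp => L.source_mul _ _ hp) (L.unit_left_mem c₀) (L.unit_mul c₀) hr.injOn

/-- Left division. -/
theorem exists_left_division {c₀ : G} (hl : L.IsLeftRegularAt c₀) :
    ∃ δ : G × G → G, ContMDiffAt ((𝓡 n).prod (𝓡 n)) (𝓡 n) ∞ δ (c₀, c₀) ∧
      δ (c₀, c₀) = L.unit (L.source c₀) ∧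
      ∀ᶠ p in 𝓝 (c₀, c₀), L.target p.1 = L.target p.2 →
        (p.2, δ p) ∈ L.mulDom ∧ L.mul p.2 (δ p) = p.1 := by
  obtain ⟨O, hO, hU⟩ := L.mulDom_open
  have hD : Prod.swap ⁻¹' L.mulDom =
      (Prod.swap ⁻¹' O) ∩ {p : G × G | L.target p.1 = L.source p.2} := by
    ext p
    rw [hU]
    exact and_congr_right fun _ => eq_comm
  -- Left division is right division for the opposite multiplication, with source and target
  -- exchanged.
  exact exists_division (m := fun a b => L.mul b a) (D := Prod.swap ⁻¹' L.mulDom)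
    L.target_submersion L.source_submersion.1 (hO.preimage continuous_swap) hD
    (L.mul_smooth.comp (g := fun p : G × G => L.mul p.1 p.2)
      (contMDiff_snd.prodMk contMDiff_fst).contMDiffOn (fun _ h => h))
    (fun p hp => L.target_mul _ _ hp) (L.unit_right_mem c₀) (L.mul_unit c₀) hl.injOn

end Basic

/-! ### Words, their values and their refinements -/

section Words

variable {n k : ℕ} {G : Type u} {M : Type v}
  [TopologicalSpace G] [ChartedSpace (EuclideanSpace ℝ (Fin n)) G]
  [TopologicalSpace M] [ChartedSpace (EuclideanSpace ℝ (Fin k)) M]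
  {L : LocalLieGroupoid n k G M}

namespace Evaluates

theorem ne_nil {w : List G} {g : G} (h : L.Evaluates w g) : w ≠ [] := by
  induction h with
  | single g => simp
  | mul _ _ _ ih _ => simp [ih]

theorem eq_of_singleton {a g : G} (h : L.Evaluates [a] g) : g = a := by
  generalize hw : [a] = w at h
  cases h with
  | single g => simpa using hw.symm
  | mul h1 h2 _ =>
    have h3 := congrArg List.length hw
    have h4 := List.length_pos_iff.2 h1.ne_nil
    have h5 := List.length_pos_iff.2 h2.ne_nil
    simp only [List.length_append, List.length_singleton] at h3
    omega

theorem eq_of_pair {a b g : G} (h : L.Evaluates [a, b] g) : g = L.mul a b := by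
  generalize hw : [a, b] = w at h
  cases h with
  | single g => simp at hw
  | @mul w₁ w₂ c d h1 h2 _ =>
    have h4 := List.length_pos_iff.2 h1.ne_nil
    have h5 := List.length_pos_iff.2 h2.ne_nil
    match w₁, w₂, h4, h5, hw with
    | [x], [y], _, _, hw =>
      simp only [List.cons_append, List.nil_append, List.cons.injEq, and_true] at hw
      rw [h1.eq_of_singleton, h2.eq_of_singleton, hw.1, hw.2]
    | x :: x' :: l, y :: l', _, _, hw => simp at hw
    | [x], y :: y' :: l', _, _, hw => simp at hw

/-- Global associativity concerns words of length at least 3, but a word of length 1 or 2 has only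
one bracketing. -/
theorem unique (hA : L.IsGloballyAssociative) {w : List G} {g h : G} (hg : L.Evaluates w g)
    (hh : L.Evaluates w h) : g = h := by
  match w, hg, hh with
  | [], hg, _ => exact absurd rfl hg.ne_nil
  | [a], hg, hh => rw [hg.eq_of_singleton, hh.eq_of_singleton]
  | [a, b], hg, hh => rw [hg.eq_of_pair, hh.eq_of_pair]
  | a :: b :: c :: l, hg, hh =>
    exact hA (a :: b :: c :: l).length (by simp) _ (by simp) le_rfl _ rfl g h hg hh

theorem cons {a g : G} {w : List G} (h : L.Evaluates w g) (hag : (a, g) ∈ L.mulDom) :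
    L.Evaluates (a :: w) (L.mul a g) :=
  (Evaluates.single a).mul h hag

end Evaluates

theorem IsGloballyAssociative.mul_assoc (hA : L.IsGloballyAssociative) {a b c : G}
    (hab : (a, b) ∈ L.mulDom) (hbc : (b, c) ∈ L.mulDom) (h1 : (L.mul a b, c) ∈ L.mulDom)
    (h2 : (a, L.mul b c) ∈ L.mulDom) : L.mul (L.mul a b) c = L.mul a (L.mul b c) :=
  Evaluates.unique (w := [a, b, c]) hA
    (Evaluates.mul (((Evaluates.single b).cons hab)) (Evaluates.single c) h1)
    (((Evaluates.single c).cons hbc).cons h2)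

variable (L) in
/-- `L.IsWord w y x`: the nonempty word `w` is composable, with target `y` and source `x`. -/
inductive IsWord : List G → M → M → Prop
  | single (g : G) : IsWord [g] (L.target g) (L.source g)
  | cons (g : G) {w : List G} {x : M} (h : IsWord w (L.source g) x) :
      IsWord (g :: w) (L.target g) x

namespace IsWord

theorem append {w w' : List G} {x y z : M} (h : L.IsWord w x y) (h' : L.IsWord w' y z) :
    L.IsWord (w ++ w') x z := by
  induction h with
  | single g => exact .cons g h'
  | cons g _ ih => exact .cons g (ih h')

theorem ne_nil {w : List G} {x y : M} (h : L.IsWord w x y) : w ≠ [] := by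
  cases h <;> simp

theorem unique {w : List G} {x y x' y' : M} (h : L.IsWord w x y) (h' : L.IsWord w x' y') :
    x = x' ∧ y = y' := by
  induction h generalizing x' with
  | single g =>
    cases h' with
    | single => exact ⟨rfl, rfl⟩
    | cons _ h => exact absurd rfl h.ne_nil
  | cons g h1 ih =>
    cases h' with
    | single => exact absurd rfl h1.ne_nil
    | cons _ h => exact ⟨rfl, (ih h).2⟩

theorem of_append {w w' : List G} {x z : M} (h : L.IsWord (w ++ w') x z) (hw : w ≠ [])
    (hw' : w' ≠ []) : ∃ y, L.IsWord w x y ∧ L.IsWord w' y z := by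
  induction w generalizing x with
  | nil => exact absurd rfl hw
  | cons g w ih =>
    rw [List.cons_append] at h
    rcases eq_or_ne w [] with rfl | hne
    · generalize hl : g :: ([] ++ w') = l at h
      cases h with
      | single a => simp_all
      | cons a h1 =>
        obtain ⟨rfl, rfl⟩ := List.cons.inj hl
        exact ⟨_, .single _, h1⟩
    · generalize hl : g :: (w ++ w') = l at h
      cases h with
      | single a => simp_all
      | cons a h1 =>
        obtain ⟨rfl, rfl⟩ := List.cons.inj hl
        obtain ⟨y, h2, h3⟩ := ih h1 hne
        exact ⟨y, .cons _ h2, h3⟩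

end IsWord

theorem Evaluates.isWord {w : List G} {g : G} (h : L.Evaluates w g) :
    L.IsWord w (L.target g) (L.source g) := by
  induction h with
  | single g => exact .single g
  | mul h1 h2 hgh ih1 ih2 =>
    rw [L.target_mul _ _ hgh, L.source_mul _ _ hgh]
    rw [source_eq_target_of_mem hgh] at ih1
    exact ih1.append ih2

variable (L) in
/-- `L.Refines y w`: the word `y` is a concatenation of words that evaluate to the letters
of `w`. -/
inductive Refines : List G → List G → Prop
  | nil : Refines [] []
  | cons {y z w : List G} {g : G} (hg : L.Evaluates y g) (h : Refines z w) :
      Refines (y ++ z) (g :: w)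

namespace Refines

theorem refl (w : List G) : L.Refines w w := by
  induction w with
  | nil => exact .nil
  | cons g w ih => exact .cons (.single g) ih

theorem append {y w y' w' : List G} (h : L.Refines y w) (h' : L.Refines y' w') :
    L.Refines (y ++ y') (w ++ w') := by
  induction h with
  | nil => exact h'
  | cons hg _ ih => rw [List.append_assoc]; exact .cons hg ih

theorem of_evaluates {y : List G} {g : G} (h : L.Evaluates y g) : L.Refines y [g] := by
  simpa using Refines.cons h .nil

theorem exists_of_append {y w w' : List G} (h : L.Refines y (w ++ w')) :
    ∃ y₁ y₂, y = y₁ ++ y₂ ∧ L.Refines y₁ w ∧ L.Refines y₂ w' := by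
  induction w generalizing y with
  | nil => exact ⟨[], y, rfl, .nil, h⟩
  | cons g w ih =>
    rw [List.cons_append] at h
    cases h with
    | cons hg h =>
      obtain ⟨y₁, y₂, rfl, h1, h2⟩ := ih h
      exact ⟨_, y₂, (List.append_assoc _ _ _).symm, .cons hg h1, h2⟩

theorem evaluates_of_singleton {y : List G} {g : G} (h : L.Refines y [g]) : L.Evaluates y g := by
  cases h with
  | cons hg h => cases h; simpa using hg

theorem evaluates {y w : List G} {g : G} (h : L.Refines y w) (hw : L.Evaluates w g) :
    L.Evaluates y g := by
  induction hw generalizing y with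
  | single g => exact h.evaluates_of_singleton
  | mul _ _ hgh ih1 ih2 =>
    obtain ⟨y₁, y₂, rfl, h1, h2⟩ := h.exists_of_append
    exact (ih1 h1).mul (ih2 h2) hgh

theorem trans {z y w : List G} (h : L.Refines z y) (h' : L.Refines y w) : L.Refines z w := by
  induction h' generalizing z with
  | nil => exact h
  | cons hg _ ih =>
    obtain ⟨z₁, z₂, rfl, h1, h2⟩ := h.exists_of_append
    exact .cons (h1.evaluates hg) (ih h2)

theorem eq_nil {y : List G} (h : L.Refines y []) : y = [] := by
  cases h; rfl

theorem isWord {y w : List G} {a b : M} (h : L.Refines y w) (hw : L.IsWord w a b) :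
    L.IsWord y a b := by
  induction hw generalizing y with
  | single g => exact h.evaluates_of_singleton.isWord
  | cons g _ ih =>
    cases h with
    | cons hg h => exact hg.isWord.append (ih h)

end Refines

variable (L) in
/-- The product `c d` can be undone by words: `C` and `D` evaluate to `c` and `d`, the words `C'`
and `D'` are inverse to them, and every word that evaluates to `c d` is cancelled by `C'`
and `D'`. -/
def IsCancellable (c d : G) : Prop :=
  ∃ C C' D D' : List G, L.Evaluates C c ∧ L.Evaluates D d ∧
    L.Evaluates (C ++ C') (L.unit (L.target c)) ∧ L.Evaluates (D' ++ D) (L.unit (L.source d)) ∧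
    ∀ w, L.Evaluates w (L.mul c d) → L.Evaluates (C' ++ w ++ D') (L.unit (L.source c))

theorem unit_unit_mem (x : M) : (L.unit x, L.unit x) ∈ L.mulDom := by
  simpa [L.source_unit] using L.unit_right_mem (L.unit x)

theorem mul_unit_unit (x : M) : L.mul (L.unit x) (L.unit x) = L.unit x := by
  simpa [L.source_unit] using L.mul_unit (L.unit x)

theorem Evaluates.mul_unit {w w' : List G} {g : G} {x : M} (h : L.Evaluates w g)
    (h' : L.Evaluates w' (L.unit x)) (hx : L.source g = x) : L.Evaluates (w ++ w') g := by
  subst hx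
  simpa [L.mul_unit] using h.mul h' (L.unit_right_mem g)

theorem Evaluates.unit_mul {w w' : List G} {g : G} {x : M} (h : L.Evaluates w (L.unit x))
    (h' : L.Evaluates w' g) (hx : L.target g = x) : L.Evaluates (w ++ w') g := by
  subst hx
  simpa [L.unit_mul] using h.mul h' (L.unit_left_mem g)

theorem isCancellable_unit (x : M) : L.IsCancellable (L.unit x) (L.unit x) := by
  have h : L.Evaluates [L.unit x] (L.unit x) := .single _
  have h2 : L.Evaluates ([L.unit x] ++ [L.unit x]) (L.unit x) := h.mul_unit h (L.source_unit x)
  refine ⟨[L.unit x], [L.unit x], [L.unit x], [L.unit x], h, h, ?_, ?_, fun w hw => ?_⟩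
  · rwa [L.target_unit]
  · rwa [L.source_unit]
  · rw [mul_unit_unit] at hw
    rw [L.source_unit]
    exact (h.unit_mul hw (L.target_unit x)).mul_unit h (L.source_unit x)

/-- The words for `c` are extended to `v :: C` and `C' ++ [v']`, whose concatenation has the value
`v v'`. Prefixing `v'` to a word for `(v c) d` gives a word for `c d`, to which the old cancelling
words apply. -/
theorem IsCancellable.mul_left {c d v v' : G} (h : L.IsCancellable c d)
    (hvc : (v, c) ∈ L.mulDom) (hvv' : (v, v') ∈ L.mulDom)
    (hv : L.mul v v' = L.unit (L.target v)) (hv' : (v', L.mul (L.mul v c) d) ∈ L.mulDom)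
    (hcd : L.mul v' (L.mul (L.mul v c) d) = L.mul c d) : L.IsCancellable (L.mul v c) d := by
  obtain ⟨C, C', D, D', hC, hD, hCC, hDD, hw⟩ := h
  refine ⟨v :: C, C' ++ [v'], D, D', hC.cons hvc, hD, ?_, hDD, fun w h => ?_⟩
  · rw [L.target_mul _ _ hvc, ← hv]
    have h1 := ((Evaluates.single v).mul_unit hCC (source_eq_target_of_mem hvc)).mul
      (Evaluates.single v') hvv'
    simpa using h1
  · rw [L.source_mul _ _ hvc]
    have h1 := h.cons hv'
    rw [hcd] at h1
    simpa using hw _ h1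

theorem IsCancellable.mul_right {c d v v' : G} (h : L.IsCancellable c d)
    (hdv : (d, v) ∈ L.mulDom) (hvv' : (v', v) ∈ L.mulDom)
    (hv : L.mul v' v = L.unit (L.source v)) (hv' : (L.mul c (L.mul d v), v') ∈ L.mulDom)
    (hcd : L.mul (L.mul c (L.mul d v)) v' = L.mul c d) : L.IsCancellable c (L.mul d v) := by
  obtain ⟨C, C', D, D', hC, hD, hCC, hDD, hw⟩ := h
  refine ⟨C, C', D ++ [v], v' :: D', hC, hD.mul (.single v) hdv, hCC, ?_, fun w h => ?_⟩
  · rw [L.source_mul _ _ hdv, ← hv]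
    have h1 := ((Evaluates.single v').mul_unit hDD
      ((source_eq_target_of_mem hvv').trans (source_eq_target_of_mem hdv).symm)).mul
      (Evaluates.single v) hvv'
    simpa using h1
  · have h1 := h.mul (.single v') hv'
    rw [hcd] at h1
    simpa using hw _ h1

end Words

end LocalLieGroupoid

namespace LocalLieGroupoid

/-! ### Consequences of connectedness: cancellation and common refinements -/

section Connected

variable {n k : ℕ} {G : Type u} {M : Type v}
  [TopologicalSpace G] [ChartedSpace (EuclideanSpace ℝ (Fin n)) G] [IsManifold (𝓡 n) ∞ G]
  [TopologicalSpace M] [ChartedSpace (EuclideanSpace ℝ (Fin k)) M] [IsManifold (𝓡 k) ∞ M]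
  {L : LocalLieGroupoid n k G M}

/-- With the middle object `x` fixed, a nearby pair is `(v c₀, d₀ w)` with `v` and `w` close to
units, hence in `𝒱`. The move goes through the intermediate pair `(c, d₀)`, changing one factor at a
time; the inverses of `v` and `w` lead back. Global associativity identifies `v (c₀ d₀)` with `c d₀`
and `(c d₀) w` with `c d`. -/
theorem eventually_isCancellable_iff (hA : L.IsGloballyAssociative) (hB : L.IsBiregular) {x : M}
    {p₀ : G × G} (hp₀ : p₀ ∈ {p : G × G | p ∈ L.mulDom ∧ L.source p.1 = x ∧ L.target p.2 = x}) :
    ∀ᶠ p in 𝓝[{p : G × G | p ∈ L.mulDom ∧ L.source p.1 = x ∧ L.target p.2 = x}] p₀,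
      L.IsCancellable p₀.1 p₀.2 ↔ L.IsCancellable p.1 p.2 := by
  obtain ⟨c₀, d₀⟩ := p₀
  obtain ⟨hcd₀, hc₀, hd₀⟩ := hp₀
  dsimp only at hcd₀ hc₀ hd₀ ⊢
  set F := {p : G × G | p ∈ L.mulDom ∧ L.source p.1 = x ∧ L.target p.2 = x} with hF
  obtain ⟨δ, hδ, hδ₀, hδm⟩ := exists_right_division (hB c₀).2
  obtain ⟨ε, hε, hε₀, hεm⟩ := exists_left_division (hB d₀).1
  have hT1 : Tendsto (fun p : G × G => p.1) (𝓝[F] (c₀, d₀)) (𝓝 c₀) :=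
    continuousAt_fst.tendsto.mono_left nhdsWithin_le_nhds
  have hT2 : Tendsto (fun p : G × G => p.2) (𝓝[F] (c₀, d₀)) (𝓝 d₀) :=
    continuousAt_snd.tendsto.mono_left nhdsWithin_le_nhds
  have hTc : Tendsto (fun p : G × G => (p.1, c₀)) (𝓝[F] (c₀, d₀)) (𝓝 (c₀, c₀)) :=
    hT1.prodMk_nhds tendsto_const_nhds
  have hTd : Tendsto (fun p : G × G => (p.2, d₀)) (𝓝[F] (c₀, d₀)) (𝓝 (d₀, d₀)) :=
    hT2.prodMk_nhds tendsto_const_nhds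
  have hv : Tendsto (fun p : G × G => δ (p.1, c₀)) (𝓝[F] (c₀, d₀)) (𝓝 (L.unit (L.target c₀))) := by
    have := hδ.continuousAt.tendsto.comp hTc
    rwa [hδ₀] at this
  have hw : Tendsto (fun p : G × G => ε (p.2, d₀)) (𝓝[F] (c₀, d₀)) (𝓝 (L.unit (L.source d₀))) := by
    have := hε.continuousAt.tendsto.comp hTd
    rwa [hε₀] at this
  have hmemF : ∀ᶠ p in 𝓝[F] (c₀, d₀), p ∈ F := eventually_mem_nhdsWithin
  have hcd : ∀ᶠ p : G × G in 𝓝[F] (c₀, d₀), (p.1, d₀) ∈ L.mulDom :=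
    eventually_mem_mulDom hT1 tendsto_const_nhds hcd₀ (by
      filter_upwards [hmemF] with p hp
      rw [hp.2.1, hd₀])
  have hcdt : Tendsto (fun p : G × G => L.mul p.1 d₀) (𝓝[F] (c₀, d₀)) (𝓝 (L.mul c₀ d₀)) :=
    tendsto_mul hT1 tendsto_const_nhds hcd₀ hcd
  have hc1 := (hv.prodMk_nhds (tendsto_const_nhds (x := c₀))).eventually
    (eventually_inv_mul_cancel c₀)
  have hu1 : L.unit (L.target c₀) = L.unit (L.target (L.mul c₀ d₀)) := by
    rw [L.target_mul _ _ hcd₀]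
  have hu2 : L.unit (L.source d₀) = L.unit (L.source (L.mul c₀ d₀)) := by
    rw [L.source_mul _ _ hcd₀]
  have hc2 := ((hu1 ▸ hv).prodMk_nhds (tendsto_const_nhds (x := L.mul c₀ d₀))).eventually
    (eventually_inv_mul_cancel (L.mul c₀ d₀))
  have hd1 := ((tendsto_const_nhds (x := d₀)).prodMk_nhds hw).eventually
    (eventually_mul_inv_cancel d₀)
  have hd2 := (hcdt.prodMk_nhds (hu2 ▸ hw)).eventually (eventually_mul_inv_cancel (L.mul c₀ d₀))
  filter_upwards [hmemF, hcd, hTc.eventually hδm, hTd.eventually hεm, hc1, hc2, hd1, hd2]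
    with p hp hcd hδm hεm hc1 hc2 hd1 hd2
  obtain ⟨c, d⟩ := p
  obtain ⟨hcd', hc, hd⟩ := hp
  dsimp only at *
  obtain ⟨h1, h2⟩ := hδm (hc.trans hc₀.symm)
  obtain ⟨h3, h4⟩ := hεm (hd.trans hd₀.symm)
  clear hδm hεm
  generalize δ (c, c₀) = v at *
  generalize ε (d, d₀) = w at *
  have hv' := source_eq_target_of_mem h1
  have hw' := source_eq_target_of_mem h3
  obtain ⟨hvV, -, h5, h6⟩ := hc1 hv'
  obtain ⟨-, h7, h8, h9⟩ := hc2 (by rw [hv', L.target_mul _ _ hcd₀])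
  obtain ⟨hwV, -, h10, h11⟩ := hd1 hw'
  obtain ⟨-, h12, h13, h14⟩ := hd2 (by rw [L.source_mul _ _ hcd, hw'])
  have h15 : L.mul v (L.mul c₀ d₀) = L.mul c d₀ := by
    rw [← h2]
    exact (hA.mul_assoc h1 hcd₀ (by rwa [h2]) h7).symm
  have h16 : L.mul (L.mul c d₀) w = L.mul c d := by
    rw [← h4]
    exact hA.mul_assoc hcd h3 h12 (by rwa [h4])
  rw [h15] at h8 h9
  rw [h16] at h13 h14
  rw [h2] at h5 h6
  rw [h4] at h10 h11
  have e1 : L.IsCancellable c₀ d₀ → L.IsCancellable c d₀ := fun h => by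
    have := h.mul_left h1 (mem_mulDom_inv hvV) (L.mul_inv v hvV) (by rwa [h2]) (by rw [h2, h9])
    rwa [h2] at this
  have e2 : L.IsCancellable c d₀ → L.IsCancellable c₀ d₀ := fun h => by
    have := h.mul_left h5 (inv_mem_mulDom hvV) (by rw [L.inv_mul v hvV, L.target_inv v hvV])
      (by rwa [h6]) (by rw [h6, h15])
    rwa [h6] at this
  have e3 : L.IsCancellable c d₀ → L.IsCancellable c d := fun h => by
    have := h.mul_right h3 (inv_mem_mulDom hwV) (L.inv_mul w hwV) (by rwa [h4]) (by rw [h4, h14])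
    rwa [h4] at this
  have e4 : L.IsCancellable c d → L.IsCancellable c d₀ := fun h => by
    have := h.mul_right h10 (mem_mulDom_inv hwV) (by rw [L.mul_inv w hwV, L.source_inv w hwV])
      (by rwa [h11]) (by rw [h11, h16])
    rwa [h11] at this
  exact ⟨fun h => e3 (e1 h), fun h => e2 (e4 h)⟩

/-- A locally constant property on the connected set of pairs in `𝒰` with middle object `s c`, which
contains the pair of units at that object. -/
theorem isCancellable (hA : L.IsGloballyAssociative) (hL : L.IsStronglyConnected) {c d : G}
    (hcd : (c, d) ∈ L.mulDom) : L.IsCancellable c d := by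
  have h := (hL.mulDom_fiber (L.source c)).isPreconnected.induction₂'
    (fun p q : G × G => L.IsCancellable p.1 p.2 ↔ L.IsCancellable q.1 q.2)
    (fun p hp => by
      filter_upwards [eventually_isCancellable_iff hA hL.biregular hp] with q hq
      exact ⟨hq, hq.symm⟩)
    (fun _ _ _ _ _ _ => Iff.trans)
    (x := (L.unit (L.source c), L.unit (L.source c))) (y := (c, d))
    ⟨unit_unit_mem _, L.source_unit _, L.target_unit _⟩
    ⟨hcd, rfl, (source_eq_target_of_mem hcd).symm⟩
  exact h.1 (isCancellable_unit _)

-- The refinement is `C C' w D' D`, cut after `C`. The second piece evaluates to `d` since `C' w D'`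
-- has unit value. The whole refines `w` because `C C'` and `D' D` evaluate to units and can be
-- absorbed into the first and the last letter of `w`.
omit [IsManifold (𝓡 n) ∞ G] [IsManifold (𝓡 k) ∞ M] in
theorem IsCancellable.exists_refines {c d : G} (hcd : (c, d) ∈ L.mulDom)
    (h : L.IsCancellable c d) {w : List G} (hw : L.Evaluates w (L.mul c d)) :
    ∃ y₁ y₂, L.Evaluates y₁ c ∧ L.Evaluates y₂ d ∧ L.Refines (y₁ ++ y₂) w := by
  obtain ⟨C, C', D, D', hC, hD, hCC, hDD, hcanc⟩ := h
  refine ⟨C, C' ++ w ++ D' ++ D, hC, (hcanc w hw).unit_mul hD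
    (source_eq_target_of_mem hcd).symm, ?_⟩
  have h1 : L.IsWord w (L.target c) (L.source d) := by
    have := hw.isWord
    rwa [L.target_mul _ _ hcd, L.source_mul _ _ hcd] at this
  -- One-letter words are treated apart: there both units are absorbed into the same letter.
  have key : ∀ (w : List G) (a b : M) (U V : List G), L.IsWord w a b →
      L.Evaluates U (L.unit a) → L.Evaluates V (L.unit b) → L.Refines (U ++ w ++ V) w := by
    intro w a b U V hw hU hV
    have hend : ∀ (w : List G) (a b : M), L.IsWord w a b → L.Evaluates V (L.unit b) →
        L.Refines (w ++ V) w := by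
      intro w a b hw
      induction hw with
      | single g => exact fun hV => .of_evaluates ((Evaluates.single g).mul_unit hV rfl)
      | cons g _ ih => exact fun hV => (Refines.of_evaluates (.single g)).append (ih hV)
    cases hw with
    | single g =>
      exact .of_evaluates ((hU.unit_mul (.single g) rfl).mul_unit hV rfl)
    | cons g hw =>
      have := (Refines.of_evaluates (hU.unit_mul (.single g) rfl)).append (hend _ _ _ hw hV)
      simpa using this
  simpa using key w _ _ _ _ h1 hCC hDD

/-- Two words with the same value have a common refinement. -/
theorem Evaluates.exists_common_refinement (hA : L.IsGloballyAssociative)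
    (hL : L.IsStronglyConnected) {w w' : List G} {g : G} (hw : L.Evaluates w g)
    (hw' : L.Evaluates w' g) : ∃ y, L.Refines y w ∧ L.Refines y w' := by
  induction hw' generalizing w with
  | single g => exact ⟨w, .refl w, .of_evaluates hw⟩
  | mul _ _ hgh ih1 ih2 =>
    -- Induction on the bracketing of `w'`: once `w` is refined so that it splits along the
    -- outermost product of `w'`, the two halves are compared separately.
    obtain ⟨y₁, y₂, h1, h2, h3⟩ := (isCancellable hA hL hgh).exists_refines hgh hw
    obtain ⟨z₁, h4, h5⟩ := ih1 h1
    obtain ⟨z₂, h6, h7⟩ := ih2 h2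
    exact ⟨z₁ ++ z₂, (h4.append h6).trans h3, h5.append h7⟩

/-- Two refinements expand each letter of `x` into words with the same value, so they can be
compared letter by letter. This confluence is what makes the identification of words transitive. -/
theorem Refines.exists_common_refinement (hA : L.IsGloballyAssociative)
    (hL : L.IsStronglyConnected) {w w' x : List G} (hw : L.Refines w x)
    (hw' : L.Refines w' x) : ∃ y, L.Refines y w ∧ L.Refines y w' := by
  induction hw generalizing w' with
  | nil => exact ⟨[], .nil, by rw [hw'.eq_nil]; exact .nil⟩
  | cons hg _ ih =>
    cases hw' with
    | cons hg' h' =>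
      obtain ⟨y₁, h1, h2⟩ := hg.exists_common_refinement hA hL hg'
      obtain ⟨y₂, h3, h4⟩ := ih h'
      exact ⟨y₁ ++ y₂, h1.append h3, h2.append h4⟩

/-- Every arrow is the product of a word of invertible arrows. -/
theorem exists_evaluates_mem_invDom (hL : L.IsStronglyConnected) (g : G) :
    ∃ w, L.Evaluates w g ∧ ∀ a ∈ w, a ∈ L.invDom := by
  -- Within a source fibre, an arrow `c` near `c₀` is `v c₀` with `v` in `𝒱`, and `c₀` is `i v`
  -- times `c`. So the property is locally constant on the connected fibre, and it holds at the
  -- unit.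
  have h := (hL.source_fiber (L.source g)).isPreconnected.induction₂'
    (fun p q : G => (∃ w, L.Evaluates w p ∧ ∀ a ∈ w, a ∈ L.invDom) ↔
      (∃ w, L.Evaluates w q ∧ ∀ a ∈ w, a ∈ L.invDom))
    (fun c₀ hc₀ => by
      obtain ⟨δ, hδ, hδ₀, hδm⟩ := exists_right_division (hL.biregular c₀).2
      have hT : Tendsto (fun c : G => (c, c₀)) (𝓝[L.source ⁻¹' {L.source g}] c₀)
          (𝓝 (c₀, c₀)) :=
        ((Continuous.prodMk_left c₀).tendsto c₀).mono_left nhdsWithin_le_nhds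
      have hv := hδ.continuousAt.tendsto.comp hT
      rw [hδ₀] at hv
      filter_upwards [eventually_mem_nhdsWithin, hT.eventually hδm,
        (hv.prodMk_nhds (tendsto_const_nhds (x := c₀))).eventually (eventually_inv_mul_cancel c₀)]
        with c hc h1 h2
      obtain ⟨h3, h4⟩ := h1 (hc.trans hc₀.symm)
      obtain ⟨h5, -, h6, h7⟩ := h2 (source_eq_target_of_mem h3)
      dsimp only [Function.comp] at h3 h4 h5 h6 h7
      rw [h4] at h6 h7
      have e : (∃ w, L.Evaluates w c₀ ∧ ∀ a ∈ w, a ∈ L.invDom) ↔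
          (∃ w, L.Evaluates w c ∧ ∀ a ∈ w, a ∈ L.invDom) := by
        constructor
        · rintro ⟨w, h8, h9⟩
          refine ⟨δ (c, c₀) :: w, ?_, by simpa [h5] using h9⟩
          have := h8.cons h3
          rwa [h4] at this
        · rintro ⟨w, h8, h9⟩
          refine ⟨L.inv (δ (c, c₀)) :: w, ?_, by simpa [L.inv_mem_invDom _ h5] using h9⟩
          have := h8.cons h6
          rwa [h7] at this
      exact ⟨e, e.symm⟩)
    (fun _ _ _ _ _ _ => Iff.trans)
    (x := L.unit (L.source g)) (y := g) (L.source_unit _) rfl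
  exact h.1 ⟨[L.unit (L.source g)], .single _, by simpa using L.unit_mem_invDom _⟩

end Connected

/-! ### Smooth families of words and their lifts along refinements -/

section Germs

variable {n k : ℕ} {G : Type u} {M : Type v}
  [TopologicalSpace G] [ChartedSpace (EuclideanSpace ℝ (Fin n)) G] [IsManifold (𝓡 n) ∞ G]
  [TopologicalSpace M] [ChartedSpace (EuclideanSpace ℝ (Fin k)) M] [IsManifold (𝓡 k) ∞ M]
  {L : LocalLieGroupoid n k G M}
  {E : Type*} [NormedAddCommGroup E] [NormedSpace ℝ E] {H : Type*} [TopologicalSpace H]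
  {I : ModelWithCorners ℝ E H} {X : Type*} [TopologicalSpace X] [ChartedSpace H X]

omit [IsManifold (𝓡 n) ∞ G] [IsManifold (𝓡 k) ∞ M] in
theorem contMDiffAt_mul {x₀ : X} {f g : X → G} (hf : ContMDiffAt I (𝓡 n) ∞ f x₀)
    (hg : ContMDiffAt I (𝓡 n) ∞ g x₀) (hfg : ∀ᶠ x in 𝓝 x₀, (f x, g x) ∈ L.mulDom) :
    ContMDiffAt I (𝓡 n) ∞ (fun x => L.mul (f x) (g x)) x₀ :=
  L.mul_smooth.contMDiffAt_comp_of_eventually (hf.prodMk hg) hfg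

omit [IsManifold (𝓡 n) ∞ G] [IsManifold (𝓡 k) ∞ M] in
/-- A smooth family of composable words whose value at `x₀` is defined has a smooth value
near `x₀`. -/
theorem Evaluates.exists_contMDiffAt {x₀ : X} {fs : List (X → G)} {c₀ : G}
    (h : L.Evaluates (fs.map (· x₀)) c₀) (hfs : ∀ f ∈ fs, ContMDiffAt I (𝓡 n) ∞ f x₀)
    (hw : ∀ᶠ x in 𝓝 x₀, ∃ a b, L.IsWord (fs.map (· x)) a b) :
    ∃ c : X → G, ContMDiffAt I (𝓡 n) ∞ c x₀ ∧ c x₀ = c₀ ∧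
      ∀ᶠ x in 𝓝 x₀, L.Evaluates (fs.map (· x)) (c x) := by
  generalize hl : fs.map (· x₀) = l at h
  induction h generalizing fs with
  | single g =>
    match fs, hl, hfs with
    | [f], hl, hfs =>
      exact ⟨f, hfs f (by simp), by simpa using hl, .of_forall fun x => .single _⟩
  | mul h1 h2 hgh ih1 ih2 =>
    obtain ⟨fs₁, fs₂, rfl, rfl, rfl⟩ := List.map_eq_append_iff.1 hl
    have hsplit : ∀ᶠ x in 𝓝 x₀, ∃ a b c, L.IsWord (fs₁.map (· x)) a b ∧
        L.IsWord (fs₂.map (· x)) b c := by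
      filter_upwards [hw] with x hx
      obtain ⟨a, c, hx⟩ := hx
      rw [List.map_append] at hx
      obtain ⟨b, h3, h4⟩ := hx.of_append (by simpa using h1.ne_nil) (by simpa using h2.ne_nil)
      exact ⟨a, b, c, h3, h4⟩
    obtain ⟨c₁, h3, rfl, h5⟩ := ih1 (fun f hf => hfs f (by simp [hf]))
      (hsplit.mono fun x ⟨a, b, c, h, _⟩ => ⟨a, b, h⟩) rfl
    obtain ⟨c₂, h6, rfl, h8⟩ := ih2 (fun f hf => hfs f (by simp [hf]))
      (hsplit.mono fun x ⟨a, b, c, _, h⟩ => ⟨b, c, h⟩) rfl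
    have h9 : ∀ᶠ x in 𝓝 x₀, (c₁ x, c₂ x) ∈ L.mulDom := by
      refine eventually_mem_mulDom h3.continuousAt h6.continuousAt hgh ?_
      filter_upwards [hsplit, h5, h8] with x ⟨a, b, c, h10, h11⟩ h12 h13
      rw [(h12.isWord.unique h10).2, (h13.isWord.unique h11).1]
    refine ⟨_, contMDiffAt_mul h3 h6 h9, rfl, ?_⟩
    filter_upwards [h5, h8, h9] with x h10 h11 h12
    rw [List.map_append]
    exact h10.mul h11 h12

/-- If a word evaluates to `c x₀`, then it can be varied smoothly so as to evaluate to `c x`. -/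
theorem Evaluates.exists_lift (hA : L.IsGloballyAssociative) (hB : L.IsBiregular) {y : List G}
    {c₀ : G} (h : L.Evaluates y c₀) {x₀ : X} {c : X → G} (hc : ContMDiffAt I (𝓡 n) ∞ c x₀)
    (hc₀ : c x₀ = c₀) :
    ∃ fs : List (X → G), fs.map (· x₀) = y ∧ (∀ f ∈ fs, ContMDiffAt I (𝓡 n) ∞ f x₀) ∧
      ∀ᶠ x in 𝓝 x₀, L.Evaluates (fs.map (· x)) (c x) := by
  induction h generalizing c with
  | single g => exact ⟨[c], by simp [hc₀], by simpa using hc, .of_forall fun x => .single _⟩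
  | @mul w₁ w₂ g h _ _ hgh ih1 ih2 =>
    -- Local sections of the source map give arbitrary smooth extensions `a` of `g` and `b` of `h`
    -- for which `a b` is defined and has the source of `c`. Right division yields a small `v` with
    -- `c = v (a b) = (v a) b`, and the induction hypotheses apply to `v a` and `b`.
    obtain ⟨τ, D, hD, hτD, hτ₀, hτ⟩ := L.source_submersion.exists_section h
    obtain ⟨σ, D', hD', hσD, hσ₀, hσ⟩ := L.source_submersion.exists_section g
    have hsc : ContMDiffAt I (𝓡 k) ∞ (fun x => L.source (c x)) x₀ :=
      ContMDiffAt.comp x₀ (g := L.source) L.source_submersion.1.contMDiffAt hc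
    have hsc₀ : L.source (c x₀) = L.source h := by rw [hc₀, L.source_mul _ _ hgh]
    let b : X → G := fun x => τ (L.source (c x))
    have hb : ContMDiffAt I (𝓡 n) ∞ b x₀ :=
      ContMDiffAt.comp x₀ (g := τ) (f := fun x => L.source (c x))
        (by rw [hsc₀]; exact (hτ _ hτD).2) hsc
    have hb₀ : b x₀ = h := by simp only [b, hsc₀, hτ₀]
    have hsb : ∀ᶠ x in 𝓝 x₀, L.source (b x) = L.source (c x) := by
      filter_upwards [hsc.continuousAt.eventually_mem (hD.mem_nhds (by rwa [hsc₀]))] with x hx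
      exact (hτ _ hx).1
    have htb : ContMDiffAt I (𝓡 k) ∞ (fun x => L.target (b x)) x₀ :=
      ContMDiffAt.comp x₀ (g := L.target) L.target_submersion.1.contMDiffAt hb
    have htb₀ : L.target (b x₀) = L.source g := by rw [hb₀, source_eq_target_of_mem hgh]
    let a : X → G := fun x => σ (L.target (b x))
    have ha : ContMDiffAt I (𝓡 n) ∞ a x₀ :=
      ContMDiffAt.comp x₀ (g := σ) (f := fun x => L.target (b x))
        (by rw [htb₀]; exact (hσ _ hσD).2) htb
    have ha₀ : a x₀ = g := by simp only [a, htb₀, hσ₀]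
    have hab : ∀ᶠ x in 𝓝 x₀, (a x, b x) ∈ L.mulDom := by
      refine eventually_mem_mulDom ha.continuousAt hb.continuousAt (by rwa [ha₀, hb₀]) ?_
      filter_upwards [htb.continuousAt.eventually_mem (hD'.mem_nhds (by rwa [htb₀]))] with x hx
      exact (hσ _ hx).1
    let p : X → G := fun x => L.mul (a x) (b x)
    have hp : ContMDiffAt I (𝓡 n) ∞ p x₀ := contMDiffAt_mul ha hb hab
    have hp₀ : p x₀ = c x₀ := by simp only [p, ha₀, hb₀, hc₀]
    obtain ⟨δ, hδ, hδ₀, hδm⟩ := exists_right_division (hB (c x₀)).2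
    have hcp : ContMDiffAt I ((𝓡 n).prod (𝓡 n)) ∞ (fun x => (c x, p x)) x₀ := hc.prodMk hp
    let v : X → G := fun x => δ (c x, p x)
    have hv : ContMDiffAt I (𝓡 n) ∞ v x₀ :=
      ContMDiffAt.comp x₀ (g := δ) (f := fun x => (c x, p x)) (by rwa [hp₀]) hcp
    have hv₀ : v x₀ = L.unit (L.target g) := by
      simp only [v, hp₀, hδ₀]
      rw [hc₀, L.target_mul _ _ hgh]
    have hvp : ∀ᶠ x in 𝓝 x₀, (v x, p x) ∈ L.mulDom ∧ L.mul (v x) (p x) = c x := by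
      have h1 : Tendsto (fun x => (c x, p x)) (𝓝 x₀) (𝓝 (c x₀, c x₀)) := by
        have := hcp.continuousAt.tendsto
        rwa [hp₀] at this
      filter_upwards [h1.eventually hδm, hsb, hab] with x h2 h3 h4
      exact h2 (by rw [L.source_mul _ _ h4, h3])
    have hva : ∀ᶠ x in 𝓝 x₀, (v x, a x) ∈ L.mulDom := by
      refine eventually_mem_mulDom hv.continuousAt ha.continuousAt ?_ ?_
      · rw [hv₀, ha₀]; exact L.unit_left_mem g
      · filter_upwards [hvp, hab] with x h1 h2
        rw [source_eq_target_of_mem h1.1, L.target_mul _ _ h2]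
    have hva' : ContMDiffAt I (𝓡 n) ∞ (fun x => L.mul (v x) (a x)) x₀ := contMDiffAt_mul hv ha hva
    have hva₀ : L.mul (v x₀) (a x₀) = g := by rw [hv₀, ha₀, L.unit_mul]
    have hvab : ∀ᶠ x in 𝓝 x₀, (L.mul (v x) (a x), b x) ∈ L.mulDom := by
      refine eventually_mem_mulDom hva'.continuousAt hb.continuousAt ?_ ?_
      · change (L.mul (v x₀) (a x₀), b x₀) ∈ L.mulDom
        rwa [hva₀, hb₀]
      filter_upwards [hva, hab] with x h1 h2
      rw [L.source_mul _ _ h1, source_eq_target_of_mem h2]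
    obtain ⟨fs₁, rfl, h1, h2⟩ := ih1 hva' hva₀
    obtain ⟨fs₂, rfl, h3, h4⟩ := ih2 hb hb₀
    refine ⟨fs₁ ++ fs₂, by simp, fun f hf => ?_, ?_⟩
    · rcases List.mem_append.1 hf with hf | hf
      exacts [h1 f hf, h3 f hf]
    · filter_upwards [h2, h4, hvab, hva, hab, hvp] with x h5 h6 h7 h8 h9 h10
      rw [List.map_append, ← h10.2, ← hA.mul_assoc h8 h9 h7 h10.1]
      exact h5.mul h6 h7

/-- Smooth families of words lift along refinements. -/
theorem Refines.exists_lift (hA : L.IsGloballyAssociative) (hB : L.IsBiregular) {y : List G}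
    {x₀ : X} {fs : List (X → G)} (hfs : ∀ f ∈ fs, ContMDiffAt I (𝓡 n) ∞ f x₀)
    (h : L.Refines y (fs.map (· x₀))) :
    ∃ gs : List (X → G), gs.map (· x₀) = y ∧ (∀ g ∈ gs, ContMDiffAt I (𝓡 n) ∞ g x₀) ∧
      ∀ᶠ x in 𝓝 x₀, L.Refines (gs.map (· x)) (fs.map (· x)) := by
  induction fs generalizing y with
  | nil =>
    rw [List.map_nil] at h
    exact ⟨[], by simp [h.eq_nil], by simp, .of_forall fun _ => .nil⟩
  | cons f fs ih =>
    rw [List.map_cons] at h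
    cases h with
    | cons hg h =>
      obtain ⟨gs₁, rfl, h1, h2⟩ := hg.exists_lift hA hB (hfs f (by simp)) rfl
      obtain ⟨gs₂, rfl, h3, h4⟩ := ih (fun f hf => hfs f (by simp [hf])) h
      refine ⟨gs₁ ++ gs₂, by simp, fun f hf => ?_, ?_⟩
      · rcases List.mem_append.1 hf with hf | hf
        exacts [h1 f hf, h3 f hf]
      · filter_upwards [h2, h4] with x h5 h6
        rw [List.map_append]
        exact .cons h5 h6

end Germs

end LocalLieGroupoid

namespace LocalLieGroupoid

/-! ### The completion as a set: words modulo common refinement -/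

section Completion

variable {n k : ℕ} {G : Type u} {M : Type v}
  [TopologicalSpace G] [ChartedSpace (EuclideanSpace ℝ (Fin n)) G]
  [TopologicalSpace M] [ChartedSpace (EuclideanSpace ℝ (Fin k)) M]
  (L : LocalLieGroupoid n k G M)

/-- Two composable words are identified if they have a common refinement. -/
def WordRel (w w' : {w : List G // ∃ y x, L.IsWord w y x}) : Prop :=
  ∃ y, L.Refines y w.1 ∧ L.Refines y w'.1

/-- The associative completion of a local Lie groupoid: composable words modulo common
refinements. -/
def Completion : Type u := Quot L.WordRel

variable {L}

theorem WordRel.ends_eq {w w' : {w : List G // ∃ y x, L.IsWord w y x}} (h : L.WordRel w w')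
    {a b a' b' : M} (hw : L.IsWord w.1 a b) (hw' : L.IsWord w'.1 a' b') : a = a' ∧ b = b' := by
  obtain ⟨y, h1, h2⟩ := h
  exact (h1.isWord hw).unique (h2.isWord hw')

namespace Completion

/-- The source of an element of the completion. -/
noncomputable def src : L.Completion → M :=
  Quot.lift (fun w => w.2.choose_spec.choose)
    fun w w' h => (h.ends_eq w.2.choose_spec.choose_spec w'.2.choose_spec.choose_spec).2

/-- The target of an element of the completion. -/
noncomputable def tgt : L.Completion → M :=
  Quot.lift (fun w => w.2.choose)
    fun w w' h => (h.ends_eq w.2.choose_spec.choose_spec w'.2.choose_spec.choose_spec).1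

/-- `Rep w α`: the word `w` represents `α`. -/
def Rep (w : List G) (α : L.Completion) : Prop :=
  ∃ h : ∃ y x, L.IsWord w y x, Quot.mk L.WordRel ⟨w, h⟩ = α

theorem exists_rep (α : L.Completion) : ∃ w, Rep w α := by
  induction α using Quot.ind with
  | mk w => exact ⟨w.1, w.2, rfl⟩

theorem _root_.LocalLieGroupoid.IsWord.exists_rep {w : List G} {a b : M} (h : L.IsWord w a b) :
    ∃ α : L.Completion, Rep w α :=
  ⟨_, ⟨a, b, h⟩, rfl⟩

namespace Rep

variable {α β : L.Completion} {w w' y : List G}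

theorem isWord (h : Rep w α) : L.IsWord w (tgt α) (src α) := by
  obtain ⟨hw, rfl⟩ := h
  exact hw.choose_spec.choose_spec

theorem ends_eq (h : Rep w α) {a b : M} (hw : L.IsWord w a b) : tgt α = a ∧ src α = b :=
  h.isWord.unique hw

theorem eq (h : Rep w α) (h' : Rep w β) : α = β := by
  obtain ⟨_, rfl⟩ := h
  obtain ⟨_, rfl⟩ := h'
  rfl

theorem of_refines (h : Rep w α) (hy : L.Refines y w) : Rep y α := by
  have hw := hy.isWord h.isWord
  obtain ⟨h', rfl⟩ := h
  exact ⟨⟨_, _, hw⟩, Quot.sound ⟨y, .refl y, hy⟩⟩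

theorem of_refined (h : Rep y α) {a b : M} (hw : L.IsWord w a b) (hy : L.Refines y w) :
    Rep w α := by
  obtain ⟨h', rfl⟩ := h
  exact ⟨⟨_, _, hw⟩, Quot.sound ⟨y, hy, .refl y⟩⟩

end Rep

/-- The image of an arrow in the completion. -/
def of (g : G) : L.Completion := Quot.mk _ ⟨[g], _, _, .single g⟩

theorem rep_of (g : G) : Rep [g] (of g : L.Completion) := ⟨_, rfl⟩

@[simp] theorem src_of (g : G) : src (of g : L.Completion) = L.source g :=
  ((rep_of g).ends_eq (.single g)).2

@[simp] theorem tgt_of (g : G) : tgt (of g : L.Completion) = L.target g :=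
  ((rep_of g).ends_eq (.single g)).1

theorem rep_of_evaluates {w : List G} {g : G} (h : L.Evaluates w g) :
    Rep w (of g : L.Completion) :=
  (rep_of g).of_refines (.of_evaluates h)

open Classical in
/-- Multiplication in the completion: concatenation of words. -/
noncomputable def mul (α β : L.Completion) : L.Completion :=
  if h : src α = tgt β then
    (((exists_rep α).choose_spec.isWord.append
      (h ▸ (exists_rep β).choose_spec.isWord)).exists_rep).choose
  else α

/-- `β` is inverse to `α`. -/
structure IsInverse (α β : L.Completion) : Prop where
  src_eq : src β = tgt α
  tgt_eq : tgt β = src α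
  mul_eq : mul α β = of (L.unit (tgt α))
  mul_eq' : mul β α = of (L.unit (src α))

theorem IsInverse.symm {α β : L.Completion} (h : IsInverse α β) : IsInverse β α :=
  ⟨h.tgt_eq.symm, h.src_eq.symm, by rw [h.tgt_eq, h.mul_eq'], by rw [h.src_eq, h.mul_eq]⟩

end Completion

variable (L) in
/-- The standing assumption of the globalization theorem. -/
class IsGlobal : Prop where
  assoc : L.IsGloballyAssociative
  conn : L.IsStronglyConnected

end Completion

/-! ### The groupoid structure of the completion -/

namespace Completion

variable {n k : ℕ} {G : Type u} {M : Type v}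
  [TopologicalSpace G] [ChartedSpace (EuclideanSpace ℝ (Fin n)) G] [IsManifold (𝓡 n) ∞ G]
  [TopologicalSpace M] [ChartedSpace (EuclideanSpace ℝ (Fin k)) M] [IsManifold (𝓡 k) ∞ M]
  {L : LocalLieGroupoid n k G M} [L.IsGlobal]

/-- Equality in the quotient only means equality under the generated equivalence relation. The
relation is already transitive: common refinements of `w₁, w₂` and of `w₂, w₃` both refine `w₂`,
hence have a common refinement themselves. -/
theorem Rep.exists_common_refinement {α : L.Completion} {w w' : List G} (h : Rep w α)
    (h' : Rep w' α) : ∃ y, L.Refines y w ∧ L.Refines y w' := by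
  obtain ⟨hw, rfl⟩ := h
  obtain ⟨hw', h'⟩ := h'
  have hE : Equivalence L.WordRel :=
    { refl := fun w => ⟨w.1, .refl _, .refl _⟩
      symm := fun ⟨y, h1, h2⟩ => ⟨y, h2, h1⟩
      trans := fun ⟨y, h1, h2⟩ ⟨z, h3, h4⟩ => by
        obtain ⟨x, h5, h6⟩ := h2.exists_common_refinement IsGlobal.assoc IsGlobal.conn h3
        exact ⟨x, h5.trans h1, h6.trans h4⟩ }
  have := (Quot.eqvGen_exact h').mono (fun _ _ h => h)
  rw [hE.eqvGen_iff] at this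
  obtain ⟨y, h1, h2⟩ := this
  exact ⟨y, h2, h1⟩

/-- A common refinement of `[g]` and `[h]` is a single word with both values, which global
associativity forces to coincide. -/
theorem of_injective : Function.Injective (of : G → L.Completion) := fun g h hgh => by
  have h1 : Rep [h] (of g : L.Completion) := hgh ▸ rep_of h
  obtain ⟨y, h2, h3⟩ := (rep_of g).exists_common_refinement h1
  exact h2.evaluates_of_singleton.unique IsGlobal.assoc h3.evaluates_of_singleton

theorem Rep.append {α β : L.Completion} {w w' : List G} (h : Rep w α) (h' : Rep w' β)
    (hαβ : src α = tgt β) : Rep (w ++ w') (mul α β) := by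
  rw [Completion.mul, dif_pos hαβ]
  have h0 := ((exists_rep α).choose_spec.isWord.append
    (hαβ ▸ (exists_rep β).choose_spec.isWord)).exists_rep.choose_spec
  obtain ⟨y, h1, h2⟩ := h.exists_common_refinement (exists_rep α).choose_spec
  obtain ⟨y', h3, h4⟩ := h'.exists_common_refinement (exists_rep β).choose_spec
  exact (h0.of_refines (h2.append h4)).of_refined
    (h.isWord.append (hαβ ▸ h'.isWord)) (h1.append h3)

theorem src_mul {α β : L.Completion} (h : src α = tgt β) : src (mul α β) = src β := by
  obtain ⟨w, hw⟩ := exists_rep α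
  obtain ⟨w', hw'⟩ := exists_rep β
  exact ((hw.append hw' h).ends_eq (hw.isWord.append (h ▸ hw'.isWord))).2

theorem tgt_mul {α β : L.Completion} (h : src α = tgt β) : tgt (mul α β) = tgt α := by
  obtain ⟨w, hw⟩ := exists_rep α
  obtain ⟨w', hw'⟩ := exists_rep β
  exact ((hw.append hw' h).ends_eq (hw.isWord.append (h ▸ hw'.isWord))).1

theorem mul_assoc {α β γ : L.Completion} (h : src α = tgt β) (h' : src β = tgt γ) :
    mul (mul α β) γ = mul α (mul β γ) := by
  obtain ⟨w, hw⟩ := exists_rep α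
  obtain ⟨w', hw'⟩ := exists_rep β
  obtain ⟨w'', hw''⟩ := exists_rep γ
  have h1 := (hw.append hw' h).append hw'' (by rwa [src_mul h])
  have h2 := hw.append (hw'.append hw'' h') (by rwa [tgt_mul h'])
  rw [List.append_assoc] at h1
  exact h1.eq h2

theorem of_mul_of {g h : G} (hgh : (g, h) ∈ L.mulDom) :
    mul (of g) (of h) = (of (L.mul g h) : L.Completion) :=
  ((rep_of g).append (rep_of h) (by simpa using source_eq_target_of_mem hgh)).eq
    (rep_of_evaluates ((Evaluates.single h).cons hgh))

theorem Rep.cons {g : G} {α : L.Completion} {w : List G} (h : Rep w α)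
    (hg : L.source g = tgt α) : Rep (g :: w) (mul (of g) α) :=
  (rep_of g).append h (by simpa)

/-- Every element is the product of an arrow with an element represented by a shorter word. -/
theorem Rep.eq_or {α : L.Completion} {g : G} {w : List G} (h : Rep (g :: w) α) :
    (w = [] ∧ α = of g) ∨ ∃ β, Rep w β ∧ L.source g = tgt β ∧ α = mul (of g) β := by
  have h1 := h.isWord
  generalize hl : g :: w = l at h1
  generalize tgt α = a at h1
  generalize src α = b at h1
  cases h1 with
  | single a =>
    obtain ⟨rfl, rfl⟩ := List.cons.inj hl
    exact .inl ⟨rfl, h.eq (rep_of _)⟩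
  | cons a h1 =>
    obtain ⟨rfl, rfl⟩ := List.cons.inj hl
    obtain ⟨β, hβ⟩ := h1.exists_rep
    have h2 := (hβ.ends_eq h1).1.symm
    exact .inr ⟨β, hβ, h2, h.eq (hβ.cons h2)⟩

/-- Induction on words: an element of the completion is an arrow or a product of an arrow
and a shorter element. -/
theorem induction_on {p : L.Completion → Prop} (α : L.Completion) (h1 : ∀ g, p (of g))
    (h2 : ∀ g α, L.source g = tgt α → p α → p (mul (of g) α)) : p α := by
  obtain ⟨w, hw⟩ := exists_rep α
  induction w generalizing α with
  | nil => exact absurd rfl hw.isWord.ne_nil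
  | cons g w ih =>
    rcases hw.eq_or with ⟨-, rfl⟩ | ⟨β, h3, h4, rfl⟩
    exacts [h1 g, h2 g β h4 (ih β h3)]

theorem mul_unit (α : L.Completion) : mul α (of (L.unit (src α))) = α := by
  refine induction_on (p := fun α => mul α (of (L.unit (src α))) = α) α (fun g => ?_)
    fun g α h ih => ?_
  · rw [src_of, of_mul_of (L.unit_right_mem g), L.mul_unit]
  · rw [src_mul (by simpa), mul_assoc (by simpa) (by simp [L.target_unit]), ih]

theorem unit_mul (α : L.Completion) : mul (of (L.unit (tgt α))) α = α := by
  refine induction_on (p := fun α => mul (of (L.unit (tgt α))) α = α) α (fun g => ?_)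
    fun g α h ih => ?_
  · rw [tgt_of, of_mul_of (L.unit_left_mem g), L.unit_mul]
  · rw [tgt_mul (by simpa), ← mul_assoc (by simp [L.source_unit]) (by simpa), tgt_of,
      of_mul_of (L.unit_left_mem g), L.unit_mul]

theorem IsInverse.unique {α β γ : L.Completion} (h : IsInverse α β) (h' : IsInverse α γ) :
    β = γ := by
  rw [← mul_unit β, h.src_eq, ← h'.mul_eq, ← mul_assoc h.src_eq h'.tgt_eq.symm, h.mul_eq',
    ← h'.tgt_eq, unit_mul]

theorem IsInverse.comp {α β α' β' : L.Completion} (h : IsInverse α β) (h' : IsInverse α' β')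
    (hα : src α = tgt α') : IsInverse (mul α α') (mul β' β) := by
  have h1 : src β' = tgt β := by rw [h'.src_eq, h.tgt_eq, hα]
  refine ⟨by rw [src_mul h1, h.src_eq, tgt_mul hα], by rw [tgt_mul h1, h'.tgt_eq, src_mul hα],
    ?_, ?_⟩
  · rw [mul_assoc hα (by rw [tgt_mul h1, h'.tgt_eq]), ← mul_assoc h'.tgt_eq.symm h1, h'.mul_eq,
      ← hα, ← h.tgt_eq, unit_mul, h.mul_eq, tgt_mul hα]
  · rw [mul_assoc h1 (by rw [tgt_mul hα, h.src_eq]), ← mul_assoc h.src_eq hα, h.mul_eq',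
      hα, unit_mul, h'.mul_eq', src_mul hα]

theorem isInverse_of {g : G} (hg : g ∈ L.invDom) :
    IsInverse (of g : L.Completion) (of (L.inv g)) := by
  refine ⟨by simp [L.source_inv g hg], by simp [L.target_inv g hg], ?_, ?_⟩
  · rw [of_mul_of (mem_mulDom_inv hg), L.mul_inv g hg, tgt_of]
  · rw [of_mul_of (inv_mem_mulDom hg), L.inv_mul g hg, src_of]

/-- The explicit reversed word is recorded along with the inverse because smoothness of inversion is
read off from it. -/
theorem Rep.exists_inverse {α : L.Completion} {w : List G} (hw : Rep w α)
    (h : ∀ g ∈ w, g ∈ L.invDom) : ∃ β, Rep (w.map L.inv).reverse β ∧ IsInverse α β := by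
  induction w generalizing α with
  | nil => exact absurd rfl hw.isWord.ne_nil
  | cons g w ih =>
    have hg : g ∈ L.invDom := h g (by simp)
    rcases hw.eq_or with ⟨rfl, rfl⟩ | ⟨α', h3, h4, rfl⟩
    · exact ⟨of (L.inv g), rep_of _, isInverse_of hg⟩
    · obtain ⟨β, h5, h6⟩ := ih h3 (fun g hg => h g (by simp [hg]))
      refine ⟨mul β (of (L.inv g)), ?_, (isInverse_of hg).comp h6 (by simpa)⟩
      simpa using h5.append (rep_of (L.inv g)) (by rw [h6.src_eq, tgt_of, L.target_inv g hg, h4])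

theorem exists_refines_mem_invDom (w : List G) :
    ∃ y, L.Refines y w ∧ ∀ g ∈ y, g ∈ L.invDom := by
  induction w with
  | nil => exact ⟨[], .nil, by simp⟩
  | cons g w ih =>
    obtain ⟨y, h1, h2⟩ := ih
    obtain ⟨z, h3, h4⟩ := exists_evaluates_mem_invDom (L := L) IsGlobal.conn g
    refine ⟨z ++ y, .cons h3 h1, fun a ha => ?_⟩
    rcases List.mem_append.1 ha with ha | ha
    exacts [h4 a ha, h2 a ha]

theorem exists_isInverse (α : L.Completion) : ∃ β, IsInverse α β := by
  obtain ⟨w, hw⟩ := exists_rep α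
  obtain ⟨y, h1, h2⟩ := exists_refines_mem_invDom (L := L) w
  obtain ⟨β, -, h⟩ := (hw.of_refines h1).exists_inverse h2
  exact ⟨β, h⟩

/-- Inversion in the completion. -/
noncomputable def inv (α : L.Completion) : L.Completion := (exists_isInverse α).choose

theorem isInverse_inv (α : L.Completion) : IsInverse α (inv α) := (exists_isInverse α).choose_spec

@[simp] theorem src_inv (α : L.Completion) : src (inv α) = tgt α := (isInverse_inv α).src_eq

@[simp] theorem tgt_inv (α : L.Completion) : tgt (inv α) = src α := (isInverse_inv α).tgt_eq

theorem mul_inv (α : L.Completion) : mul α (inv α) = of (L.unit (tgt α)) :=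
  (isInverse_inv α).mul_eq

theorem inv_mul (α : L.Completion) : mul (inv α) α = of (L.unit (src α)) :=
  (isInverse_inv α).mul_eq'

theorem inv_inv (α : L.Completion) : inv (inv α) = α :=
  (isInverse_inv (inv α)).unique (isInverse_inv α).symm

theorem Rep.reverse {α : L.Completion} {w : List G} (hw : Rep w α) (h : ∀ g ∈ w, g ∈ L.invDom) :
    Rep (w.map L.inv).reverse (inv α) := by
  obtain ⟨β, h1, h2⟩ := hw.exists_inverse h
  rwa [(isInverse_inv α).unique h2]

theorem mul_inv_mul {α β : L.Completion} (h : src α = src β) : mul (mul α (inv β)) β = α := by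
  rw [mul_assoc (by simpa) (by simp), inv_mul, ← h, mul_unit]

theorem mul_mul_inv {α β : L.Completion} (h : src α = tgt β) : mul (mul α β) (inv β) = α := by
  rw [mul_assoc h (by simp), mul_inv, ← h, mul_unit]

end Completion

end LocalLieGroupoid

namespace LocalLieGroupoid.Completion

variable {n k : ℕ} {G : Type u} {M : Type v}
  [TopologicalSpace G] [ChartedSpace (EuclideanSpace ℝ (Fin n)) G]
  [TopologicalSpace M] [ChartedSpace (EuclideanSpace ℝ (Fin k)) M]
  {L : LocalLieGroupoid n k G M}

/-! ### Plots: maps to the completion given by smooth words -/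

section Plots

variable {E : Type*} [NormedAddCommGroup E] [NormedSpace ℝ E] {H : Type*} [TopologicalSpace H]
  {I : ModelWithCorners ℝ E H} {X : Type*} [TopologicalSpace X] [ChartedSpace H X]
  {E' : Type*} [NormedAddCommGroup E'] [NormedSpace ℝ E'] {H' : Type*} [TopologicalSpace H']
  {I' : ModelWithCorners ℝ E' H'} {Y : Type*} [TopologicalSpace Y] [ChartedSpace H' Y]

variable (I) in
/-- Near `x₀`, the map `f` is represented by a word of smooth families of arrows. -/
def PlotAt (f : X → L.Completion) (x₀ : X) : Prop :=
  ∃ fs : List (X → G), (∀ g ∈ fs, ContMDiffAt I (𝓡 n) ∞ g x₀) ∧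
    ∀ᶠ x in 𝓝 x₀, Rep (fs.map (· x)) (f x)

theorem plotAt_of {g : X → G} {x₀ : X} (hg : ContMDiffAt I (𝓡 n) ∞ g x₀) :
    PlotAt I (fun x => (of (g x) : L.Completion)) x₀ :=
  ⟨[g], by simpa using hg, .of_forall fun x => rep_of (g x)⟩

namespace PlotAt

variable {f f' : X → L.Completion} {x₀ : X}

theorem congr (h : PlotAt I f x₀) (hf : ∀ᶠ x in 𝓝 x₀, f' x = f x) : PlotAt I f' x₀ := by
  obtain ⟨fs, h1, h2⟩ := h
  refine ⟨fs, h1, ?_⟩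
  filter_upwards [h2, hf] with x h3 h4
  rwa [h4]

theorem comp {y₀ : Y} {φ : Y → X} (h : PlotAt I f (φ y₀)) (hφ : ContMDiffAt I' I ∞ φ y₀) :
    PlotAt I' (fun y => f (φ y)) y₀ := by
  obtain ⟨fs, h1, h2⟩ := h
  refine ⟨fs.map (· ∘ φ), fun g hg => ?_, ?_⟩
  · obtain ⟨g', hg', rfl⟩ := List.mem_map.1 hg
    exact (h1 g' hg').comp y₀ hφ
  · filter_upwards [hφ.continuousAt.eventually h2] with y hy
    simpa [Function.comp_def] using hy

theorem contMDiffAt_src (h : PlotAt I f x₀) : ContMDiffAt I (𝓡 k) ∞ (fun x => src (f x)) x₀ := by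
  obtain ⟨fs, h1, h2⟩ := h
  have hne : fs ≠ [] := by simpa using h2.self_of_nhds.isWord.ne_nil
  obtain ⟨gs, g, rfl⟩ : ∃ gs g, fs = gs ++ [g] :=
    ⟨fs.dropLast, fs.getLast hne, (List.dropLast_append_getLast hne).symm⟩
  have h3 : ContMDiffAt I (𝓡 k) ∞ (fun x => L.source (g x)) x₀ :=
    ContMDiffAt.comp x₀ (g := L.source) L.source_submersion.1.contMDiffAt (h1 g (by simp))
  refine h3.congr_of_eventuallyEq ?_
  filter_upwards [h2] with x hx
  have h4 := hx.isWord
  rw [List.map_append] at h4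
  rcases eq_or_ne gs [] with rfl | hgs
  · exact (h4.unique (.single (g x))).2
  · obtain ⟨y, -, h5⟩ := h4.of_append (by simpa using hgs) (by simp)
    exact (h5.unique (.single (g x))).2

theorem contMDiffAt_tgt (h : PlotAt I f x₀) : ContMDiffAt I (𝓡 k) ∞ (fun x => tgt (f x)) x₀ := by
  obtain ⟨fs, h1, h2⟩ := h
  match fs, h1, h2 with
  | [], _, h2 => exact absurd rfl h2.self_of_nhds.isWord.ne_nil
  | g :: gs, h1, h2 =>
    have h3 : ContMDiffAt I (𝓡 k) ∞ (fun x => L.target (g x)) x₀ :=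
      ContMDiffAt.comp x₀ (g := L.target) L.target_submersion.1.contMDiffAt (h1 g (by simp))
    refine h3.congr_of_eventuallyEq ?_
    filter_upwards [h2] with x hx
    have h4 := hx.isWord
    rcases eq_or_ne gs [] with rfl | hgs
    · exact (h4.unique (.single (g x))).1
    · rw [List.map_cons, ← List.singleton_append] at h4
      obtain ⟨y, h5, -⟩ := h4.of_append (by simp) (by simpa using hgs)
      exact (h5.unique (.single (g x))).1

end PlotAt

variable [IsManifold (𝓡 n) ∞ G] [IsManifold (𝓡 k) ∞ M] [L.IsGlobal]

namespace PlotAt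

variable {f f' : X → L.Completion} {x₀ : X}

protected theorem mul (h : PlotAt I f x₀) (h' : PlotAt I f' x₀)
    (hff : ∀ᶠ x in 𝓝 x₀, src (f x) = tgt (f' x)) : PlotAt I (fun x => mul (f x) (f' x)) x₀ := by
  obtain ⟨fs, h1, h2⟩ := h
  obtain ⟨gs, h3, h4⟩ := h'
  refine ⟨fs ++ gs, fun g hg => ?_, ?_⟩
  · rcases List.mem_append.1 hg with hg | hg
    exacts [h1 g hg, h3 g hg]
  · filter_upwards [h2, h4, hff] with x h5 h6 h7
    rw [List.map_append]
    exact h5.append h6 h7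

/-- A plot can be represented by smooth families of refinements of any given word. -/
theorem exists_lift {fs : List (X → G)} (h1 : ∀ g ∈ fs, ContMDiffAt I (𝓡 n) ∞ g x₀)
    (h2 : ∀ᶠ x in 𝓝 x₀, Rep (fs.map (· x)) (f x)) {y : List G}
    (hy : L.Refines y (fs.map (· x₀))) :
    ∃ gs : List (X → G), gs.map (· x₀) = y ∧ (∀ g ∈ gs, ContMDiffAt I (𝓡 n) ∞ g x₀) ∧
      ∀ᶠ x in 𝓝 x₀, Rep (gs.map (· x)) (f x) := by
  obtain ⟨gs, h3, h4, h5⟩ := hy.exists_lift IsGlobal.assoc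
    (IsStronglyConnected.biregular IsGlobal.conn) h1
  refine ⟨gs, h3, h4, ?_⟩
  filter_upwards [h2, h5] with x h6 h7
  exact h6.of_refines h7

/-- The word at `x₀` is first refined into letters from `𝒱`, and this refinement is lifted to nearby
points. The letters stay in the open set `𝒱`, so they can be inverted one by one and the word
reversed. -/
protected theorem inv (h : PlotAt I f x₀) : PlotAt I (fun x => inv (f x)) x₀ := by
  obtain ⟨fs, h1, h2⟩ := h
  obtain ⟨y, h3, h4⟩ := exists_refines_mem_invDom (L := L) (fs.map (· x₀))
  obtain ⟨gs, rfl, h5, h6⟩ := exists_lift h1 h2 h3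
  refine ⟨(gs.map (L.inv ∘ ·)).reverse, fun g hg => ?_, ?_⟩
  · obtain ⟨g', hg', rfl⟩ := List.mem_map.1 (List.mem_reverse.1 hg)
    have h7 : g' x₀ ∈ L.invDom := h4 _ (List.mem_map.2 ⟨g', hg', rfl⟩)
    exact (L.inv_smooth.contMDiffAt (L.invDom_open.mem_nhds h7)).comp x₀ (h5 g' hg')
  · have h7 : ∀ᶠ x in 𝓝 x₀, ∀ g ∈ gs, g x ∈ L.invDom := by
      have h8 : ∀ᶠ x in 𝓝 x₀, ∀ g ∈ {g | g ∈ gs}, g x ∈ L.invDom :=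
        (Filter.eventually_all_finite gs.finite_toSet).2 fun g hg =>
          (h5 g hg).continuousAt.eventually_mem
            (L.invDom_open.mem_nhds (h4 _ (List.mem_map.2 ⟨g, hg, rfl⟩)))
      exact h8
    filter_upwards [h6, h7] with x h8 h9
    have := h8.reverse (by simpa using h9)
    simpa [Function.comp_def] using this

/-- A plot with value an arrow of `G` at `x₀` is a smooth family of arrows of `G` near `x₀`. -/
theorem exists_of (h : PlotAt I f x₀) {g₀ : G} (h₀ : f x₀ = of g₀) :
    ∃ g : X → G, ContMDiffAt I (𝓡 n) ∞ g x₀ ∧ g x₀ = g₀ ∧ ∀ᶠ x in 𝓝 x₀, f x = of (g x) := by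
  obtain ⟨fs, h1, h2⟩ := h
  have h3 := h2.self_of_nhds
  rw [h₀] at h3
  -- As a refinement of the given word, `y` lifts to nearby points; as a refinement of `[g₀]`, it
  -- evaluates to `g₀`, so the lifted words also have values near `x₀`, and these vary smoothly.
  obtain ⟨y, h4, h5⟩ := h3.exists_common_refinement (rep_of g₀)
  obtain ⟨gs, rfl, h6, h7⟩ := exists_lift h1 h2 h4
  obtain ⟨g, h8, h9, h10⟩ := h5.evaluates_of_singleton.exists_contMDiffAt h6
    (h7.mono fun x hx => ⟨_, _, hx.isWord⟩)
  refine ⟨g, h8, h9, ?_⟩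
  filter_upwards [h7, h10] with x h11 h12
  exact h11.eq (rep_of_evaluates h12)

end PlotAt

end Plots

variable [IsManifold (𝓡 n) ∞ G] [IsManifold (𝓡 k) ∞ M] [L.IsGlobal]

/-! ### Local sections of the source map and charts of the completion -/

/-- Local sections of the source map through any element. -/
theorem exists_section (α₀ : L.Completion) : ∃ (τ : M → L.Completion) (D : Set M), IsOpen D ∧
    src α₀ ∈ D ∧ τ (src α₀) = α₀ ∧ ∀ y ∈ D, src (τ y) = y ∧ PlotAt (𝓡 k) τ y := by
  refine induction_on (p := fun α₀ => ∃ (τ : M → L.Completion) (D : Set M), IsOpen D ∧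
    src α₀ ∈ D ∧ τ (src α₀) = α₀ ∧ ∀ y ∈ D, src (τ y) = y ∧ PlotAt (𝓡 k) τ y) α₀
    (fun g => ?_) fun g α h ih => ?_
  · obtain ⟨τ, D, hD, h1, h2, h3⟩ := L.source_submersion.exists_section g
    exact ⟨fun y => of (τ y), D, hD, by simpa, by simp [h2],
      fun y hy => ⟨by simp [(h3 y hy).1], plotAt_of (h3 y hy).2⟩⟩
  · obtain ⟨σ, D', hD', h1, h2, h3⟩ := L.source_submersion.exists_section g
    obtain ⟨τ, D, hD, h4, h5, h6⟩ := ih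
    have hs : src (mul (of g) α) = src α := src_mul (by simpa)
    have hc : ContinuousOn (fun y => tgt (τ y)) D := fun y hy =>
      (h6 y hy).2.contMDiffAt_tgt.continuousAt.continuousWithinAt
    have hcomp : ∀ y ∈ D ∩ (fun y => tgt (τ y)) ⁻¹' D',
        src (of (σ (tgt (τ y))) : L.Completion) = tgt (τ y) := fun y hy => by
      rw [src_of, (h3 _ hy.2).1]
    have ho := hc.isOpen_inter_preimage hD hD'
    refine ⟨fun y => mul (of (σ (tgt (τ y)))) (τ y), _, ho, ?_, ?_, fun y hy => ⟨?_, ?_⟩⟩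
    · rw [hs]
      refine ⟨h4, ?_⟩
      change tgt (τ (src α)) ∈ D'
      rwa [h5, ← h]
    · rw [hs]
      change mul (of (σ (tgt (τ (src α))))) (τ (src α)) = _
      rw [h5, ← h, h2]
    · rw [src_mul (hcomp y hy), (h6 y hy.1).1]
    · refine PlotAt.mul (plotAt_of ?_) (h6 y hy.1).2 ?_
      · exact ContMDiffAt.comp y (g := σ) (f := fun y => tgt (τ y)) (h3 _ hy.2).2
          (h6 y hy.1).2.contMDiffAt_tgt
      · filter_upwards [ho.mem_nhds hy] with z hz
        exact hcomp z hz

open Classical in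
/-- The partial inverse of `of`. -/
noncomputable def toArrow (α : L.Completion) : G :=
  if h : ∃ g, of g = α then h.choose else L.unit (src α)

@[simp] theorem toArrow_of (g : G) : toArrow (of g : L.Completion) = g := by
  have h : ∃ g', (of g' : L.Completion) = of g := ⟨g, rfl⟩
  rw [toArrow, dif_pos h]
  exact of_injective h.choose_spec

theorem PlotAt.contMDiffAt_toArrow {E : Type*} [NormedAddCommGroup E] [NormedSpace ℝ E]
    {H : Type*} [TopologicalSpace H] {I : ModelWithCorners ℝ E H} {X : Type*} [TopologicalSpace X]
    [ChartedSpace H X] {f : X → L.Completion} {x₀ : X} (h : PlotAt I f x₀)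
    (h₀ : f x₀ ∈ range of) : ContMDiffAt I (𝓡 n) ∞ (fun x => toArrow (f x)) x₀ ∧
      ∀ᶠ x in 𝓝 x₀, f x = of (toArrow (f x)) := by
  obtain ⟨g₀, h₀⟩ := h₀
  obtain ⟨g, h1, -, h3⟩ := h.exists_of h₀.symm
  refine ⟨h1.congr_of_eventuallyEq ?_, ?_⟩
  · filter_upwards [h3] with x hx
    rw [hx, toArrow_of]
  · filter_upwards [h3] with x hx
    rw [hx, toArrow_of]

/-- The data for a chart around `α₀`: a section of the source map through `α₀` and a slice chart of
the source map of `G`. -/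
structure ChartData (α₀ : L.Completion) where
  τ : M → L.Completion
  D : Set M
  isOpen : IsOpen D
  mem : src α₀ ∈ D
  τ_src : τ (src α₀) = α₀
  src_τ : ∀ y ∈ D, src (τ y) = y
  plot : ∀ y ∈ D, PlotAt (𝓡 k) τ y
  slice : SliceChart n k L.source (L.unit (tgt α₀))

theorem nonempty_chartData (α₀ : L.Completion) : Nonempty (ChartData α₀) := by
  obtain ⟨τ, D, h1, h2, h3, h4⟩ := exists_section α₀
  obtain ⟨c⟩ := L.source_submersion.nonempty_sliceChart (L.unit (tgt α₀))
  exact ⟨⟨τ, D, h1, h2, h3, fun y hy => (h4 y hy).1, fun y hy => (h4 y hy).2, c⟩⟩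

namespace ChartData

variable {α₀ : L.Completion} (c : ChartData α₀)

/-- The small arrow `v` with `α = v * τ (src α)`. -/
noncomputable def quot (α : L.Completion) : L.Completion := mul α (inv (c.τ (src α)))

/-- The chart of `M` used for the source. -/
noncomputable def χ (_ : ChartData α₀) : OpenPartialHomeomorph M (EuclideanSpace ℝ (Fin k)) :=
  chartAt _ (src α₀)

/-- The chart of `M` used for the slice. -/
noncomputable def χ' (_ : ChartData α₀) : OpenPartialHomeomorph M (EuclideanSpace ℝ (Fin k)) :=
  chartAt _ (L.source (L.unit (tgt α₀)))

/-- The source of the element with coordinate `z`. -/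
noncomputable def base (z : EuclideanSpace ℝ (Fin n)) : M := c.χ.symm (c.slice.P z)

/-- The slice coordinate of the small arrow of the element with coordinate `z`. -/
noncomputable def coord (z : EuclideanSpace ℝ (Fin n)) : EuclideanSpace ℝ (Fin n) :=
  c.slice.J (c.χ' (tgt (c.τ (c.base z)))) + (z - c.slice.J (c.slice.P z))

/-- The domain of the chart. -/
def domain : Set L.Completion :=
  {α | src α ∈ c.χ.source ∧ src α ∈ c.D ∧ ∃ v ∈ c.slice.θ.source, c.quot α = of v}

/-- The range of the chart. -/
def codomain : Set (EuclideanSpace ℝ (Fin n)) :=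
  {z | c.slice.P z ∈ c.χ.target ∧ c.base z ∈ c.D ∧ tgt (c.τ (c.base z)) ∈ c.χ'.source ∧
    c.coord z ∈ c.slice.θ.target}

/-- The chart. -/
noncomputable def toFun (α : L.Completion) : EuclideanSpace ℝ (Fin n) :=
  -- The `P`-part records the source of `α`, and the part in the kernel of `P` records the position
  -- of the small arrow in its source fibre. The `P`-part of the small arrow itself is dropped: it
  -- is determined by the target of `τ (src α)` and is restored by `coord`.
  c.slice.J (c.χ (src α)) + (c.slice.θ (toArrow (c.quot α)) -
    c.slice.J (c.slice.P (c.slice.θ (toArrow (c.quot α)))))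

/-- The inverse of the chart. -/
noncomputable def invFun (z : EuclideanSpace ℝ (Fin n)) : L.Completion :=
  mul (of (c.slice.θ.symm (c.coord z))) (c.τ (c.base z))

theorem P_toFun (α : L.Completion) : c.slice.P (c.toFun α) = c.χ (src α) := by
  simp [toFun, c.slice.P_J]

theorem base_toFun {α : L.Completion} (hα : α ∈ c.domain) : c.base (c.toFun α) = src α := by
  rw [base, P_toFun, c.χ.left_inv hα.1]

omit [IsManifold (𝓡 n) ∞ G] [IsManifold (𝓡 k) ∞ M] [L.IsGlobal] in
theorem src_coord {z : EuclideanSpace ℝ (Fin n)} (hz : z ∈ c.codomain) :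
    L.source (c.slice.θ.symm (c.coord z)) = tgt (c.τ (c.base z)) := by
  refine c.slice.apply_symm hz.2.2.2 hz.2.2.1 ?_
  simp [coord, c.slice.P_J, χ']

theorem source_of_quot {α : L.Completion} (hα : α ∈ c.domain) {v : G} (hv : c.quot α = of v) :
    L.source v = tgt (c.τ (src α)) := by
  rw [← src_of (L := L) v, ← hv, quot, src_mul, src_inv]
  rw [tgt_inv, c.src_τ _ hα.2.1]

theorem coord_toFun {α : L.Completion} (hα : α ∈ c.domain) :
    c.coord (c.toFun α) = c.slice.θ (toArrow (c.quot α)) := by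
  obtain ⟨v, hv, h⟩ := hα.2.2
  have h1 : c.χ' (tgt (c.τ (src α))) = c.slice.P (c.slice.θ v) := by
    rw [← c.source_of_quot hα h]
    exact c.slice.proj v hv
  rw [coord, c.base_toFun hα, P_toFun, h, toArrow_of, h1, toFun, h, toArrow_of]
  abel

/-- The chart as a bijection between its domain and its codomain. -/
noncomputable def toPartialEquiv : PartialEquiv L.Completion (EuclideanSpace ℝ (Fin n)) where
  toFun := c.toFun
  invFun := c.invFun
  source := c.domain
  target := c.codomain
  map_source' α hα := by
    obtain ⟨v, hv, h⟩ := hα.2.2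
    refine ⟨?_, ?_, ?_, ?_⟩
    · rw [P_toFun]; exact c.χ.map_source hα.1
    · rw [c.base_toFun hα]; exact hα.2.1
    · rw [c.base_toFun hα, ← c.source_of_quot hα h]
      exact c.slice.maps v hv
    · rw [c.coord_toFun hα, h, toArrow_of]
      exact c.slice.θ.map_source hv
  map_target' z hz := by
    have h1 := c.src_coord hz
    have h2 : src (c.invFun z) = c.base z := by
      rw [invFun, src_mul (by rw [src_of, h1]), c.src_τ _ hz.2.1]
    refine ⟨?_, ?_, c.slice.θ.symm (c.coord z), c.slice.θ.map_target hz.2.2.2, ?_⟩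
    · rw [h2]; exact c.χ.map_target hz.1
    · rw [h2]; exact hz.2.1
    · rw [quot, h2, invFun, mul_mul_inv (by rw [src_of, h1])]
  left_inv' α hα := by
    obtain ⟨v, hv, h⟩ := hα.2.2
    rw [invFun, c.coord_toFun hα, c.base_toFun hα, h, toArrow_of, c.slice.θ.left_inv hv, ← h, quot,
      mul_inv_mul (c.src_τ _ hα.2.1).symm]
  right_inv' z hz := by
    have h1 := c.src_coord hz
    have h2 : src (c.invFun z) = c.base z := by
      rw [invFun, src_mul (by rw [src_of, h1]), c.src_τ _ hz.2.1]
    have h3 : c.quot (c.invFun z) = of (c.slice.θ.symm (c.coord z)) := by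
      rw [quot, h2, invFun, mul_mul_inv (by rw [src_of, h1])]
    rw [toFun, h2, h3, toArrow_of, c.slice.θ.right_inv hz.2.2.2, base, c.χ.right_inv hz.1, coord]
    simp only [map_add, map_sub, c.slice.P_J]
    abel

/-- Together with `PlotAt.chart` this gives smooth transition maps: an inverse chart is a plot, and
a plot read in any other chart is smooth. Openness is stated in coordinates since the completion has
no topology yet. -/
theorem eventually_mem_codomain {z : EuclideanSpace ℝ (Fin n)} (hz : z ∈ c.codomain) :
    (∀ᶠ z' in 𝓝 z, z' ∈ c.codomain) ∧ PlotAt (𝓡 n) c.invFun z := by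
  have hP : ContMDiffAt (𝓡 n) (𝓡 k) ∞ c.slice.P z := c.slice.P.contDiff.contMDiff.contMDiffAt
  have hb : ContMDiffAt (𝓡 n) (𝓡 k) ∞ c.base z :=
    ContMDiffAt.comp z (g := c.χ.symm) (contMDiffAt_chartAt_symm hz.1) hP
  have hτ : PlotAt (𝓡 n) (fun z => c.τ (c.base z)) z := (c.plot _ hz.2.1).comp hb
  have ht := hτ.contMDiffAt_tgt
  have hq : ContDiff ℝ ∞ (fun z : EuclideanSpace ℝ (Fin n) => z - c.slice.J (c.slice.P z)) :=
    contDiff_id.sub (c.slice.J.contDiff.comp c.slice.P.contDiff)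
  have hχ : ContMDiffAt (𝓡 n) (𝓡 k) ∞ (fun z => c.χ' (tgt (c.τ (c.base z)))) z :=
    ContMDiffAt.comp z (g := c.χ') (f := fun z => tgt (c.τ (c.base z)))
      (contMDiffAt_chartAt hz.2.2.1) ht
  have hc : ContMDiffAt (𝓡 n) (𝓡 n) ∞ c.coord z :=
    (ContMDiffAt.comp z (g := c.slice.J) c.slice.J.contDiff.contMDiff.contMDiffAt hχ).add
      hq.contMDiff.contMDiffAt
  have hmem : ∀ᶠ z' in 𝓝 z, z' ∈ c.codomain := by
    filter_upwards [hP.continuousAt.eventually_mem (c.χ.open_target.mem_nhds hz.1),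
      hb.continuousAt.eventually_mem (c.isOpen.mem_nhds hz.2.1),
      ht.continuousAt.eventually_mem (c.χ'.open_source.mem_nhds hz.2.2.1),
      hc.continuousAt.eventually_mem (c.slice.θ.open_target.mem_nhds hz.2.2.2)] with z' h1 h2 h3 h4
    exact ⟨h1, h2, h3, h4⟩
  refine ⟨hmem, PlotAt.mul (plotAt_of ?_) hτ ?_⟩
  · exact ContMDiffAt.comp z (g := c.slice.θ.symm) (c.slice.smooth_symm _ hz.2.2.2) hc
  · filter_upwards [hmem] with z' hz'
    rw [src_of, c.src_coord hz']

/-- The small arrow is obtained from the plot by multiplication and inversion, so it is again a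
plot; being an arrow of `G` at `x₀`, it is a smooth family of arrows of `G` nearby. -/
theorem _root_.LocalLieGroupoid.Completion.PlotAt.chart
    {E : Type*} [NormedAddCommGroup E] [NormedSpace ℝ E]
    {H : Type*} [TopologicalSpace H] {I : ModelWithCorners ℝ E H} {X : Type*} [TopologicalSpace X]
    [ChartedSpace H X] {f : X → L.Completion} {x₀ : X} (h : PlotAt I f x₀)
    (hx : f x₀ ∈ c.domain) : (∀ᶠ x in 𝓝 x₀, f x ∈ c.domain) ∧
      ContMDiffAt I (𝓡 n) ∞ (fun x => c.toFun (f x)) x₀ := by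
  have hs := h.contMDiffAt_src
  have hD : ∀ᶠ x in 𝓝 x₀, src (f x) ∈ c.D :=
    hs.continuousAt.eventually_mem (c.isOpen.mem_nhds hx.2.1)
  have hq : PlotAt I (fun x => c.quot (f x)) x₀ := by
    refine h.mul (PlotAt.comp (f := c.τ) (φ := fun x => src (f x)) (c.plot _ hx.2.1) hs).inv ?_
    filter_upwards [hD] with x hx
    rw [tgt_inv, c.src_τ _ hx]
  obtain ⟨v, hv, hqv⟩ := hx.2.2
  obtain ⟨h1, h2⟩ := hq.contMDiffAt_toArrow ⟨v, hqv.symm⟩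
  have hv' : toArrow (c.quot (f x₀)) ∈ c.slice.θ.source := by rwa [hqv, toArrow_of]
  constructor
  · filter_upwards [hD, h2, hs.continuousAt.eventually_mem (c.χ.open_source.mem_nhds hx.1),
      h1.continuousAt.eventually_mem (c.slice.θ.open_source.mem_nhds hv')] with x h3 h4 h5 h6
    exact ⟨h5, h3, _, h6, h4⟩
  · have h3 : ContMDiffAt I (𝓡 k) ∞ (fun x => c.χ (src (f x))) x₀ :=
      ContMDiffAt.comp x₀ (g := c.χ) (f := fun x => src (f x)) (contMDiffAt_chartAt hx.1) hs
    have h4 : ContMDiffAt I (𝓡 n) ∞ (fun x => c.slice.θ (toArrow (c.quot (f x)))) x₀ :=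
      ContMDiffAt.comp x₀ (g := c.slice.θ) (f := fun x => toArrow (c.quot (f x)))
        (c.slice.smooth _ hv') h1
    have h5 : ContDiff ℝ ∞ (fun z : EuclideanSpace ℝ (Fin n) => z - c.slice.J (c.slice.P z)) :=
      contDiff_id.sub (c.slice.J.contDiff.comp c.slice.P.contDiff)
    exact (ContMDiffAt.comp x₀ (g := c.slice.J) c.slice.J.contDiff.contMDiff.contMDiffAt h3).add
      (h5.contMDiff.contMDiffAt.comp x₀ h4)

theorem mem_domain : α₀ ∈ c.domain := by
  refine ⟨mem_chart_source _ _, c.mem, L.unit (tgt α₀), c.slice.mem_source, ?_⟩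
  rw [quot, c.τ_src, mul_inv]

end ChartData

end LocalLieGroupoid.Completion

/-! ### The manifold structure and smoothness of the operations -/

namespace LocalLieGroupoid.Completion

variable {n k : ℕ} {G : Type u} {M : Type v}
  [TopologicalSpace G] [ChartedSpace (EuclideanSpace ℝ (Fin n)) G] [IsManifold (𝓡 n) ∞ G]
  [TopologicalSpace M] [ChartedSpace (EuclideanSpace ℝ (Fin k)) M] [IsManifold (𝓡 k) ∞ M]
  {L : LocalLieGroupoid n k G M} [L.IsGlobal]

/-- The chosen chart data at `α`. -/
noncomputable def chartData (α : L.Completion) : ChartData α := (nonempty_chartData α).some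

theorem transition_source_eventually (α β : L.Completion) {z : EuclideanSpace ℝ (Fin n)}
    (hz : z ∈ ((chartData α).toPartialEquiv.symm.trans (chartData β).toPartialEquiv).source) :
    (∀ᶠ z' in 𝓝 z, z' ∈
      ((chartData α).toPartialEquiv.symm.trans (chartData β).toPartialEquiv).source) ∧
    ContMDiffAt (𝓡 n) (𝓡 n) ∞
      ((chartData α).toPartialEquiv.symm.trans (chartData β).toPartialEquiv) z := by
  rw [PartialEquiv.trans_source] at hz ⊢
  obtain ⟨h1, h2⟩ := (chartData α).eventually_mem_codomain hz.1
  obtain ⟨h3, h4⟩ := h2.chart (chartData β) hz.2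
  refine ⟨?_, h4⟩
  filter_upwards [h1, h3] with z' h5 h6
  exact ⟨h5, h6⟩

variable (L) in
/-- The atlas of the completion. -/
noncomputable def chartedSpaceCore : ChartedSpaceCore (EuclideanSpace ℝ (Fin n)) L.Completion where
  atlas := range fun α => (chartData α).toPartialEquiv
  chartAt α := (chartData α).toPartialEquiv
  mem_chart_source α := (chartData α).mem_domain
  chart_mem_atlas α := mem_range_self α
  open_source := by
    rintro _ _ ⟨α, rfl⟩ ⟨β, rfl⟩
    exact isOpen_iff_eventually.2 fun z hz => (transition_source_eventually α β hz).1
  continuousOn_toFun := by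
    rintro _ _ ⟨α, rfl⟩ ⟨β, rfl⟩ z hz
    exact (transition_source_eventually α β hz).2.continuousAt.continuousWithinAt

noncomputable instance : TopologicalSpace L.Completion := (chartedSpaceCore L).toTopologicalSpace

noncomputable instance : ChartedSpace (EuclideanSpace ℝ (Fin n)) L.Completion :=
  (chartedSpaceCore L).toChartedSpace

instance : IsManifold (𝓡 n) ∞ L.Completion := by
  refine isManifold_of_contDiffOn (𝓡 n) ∞ _ ?_
  intro e e' he he'
  simp only [atlas, ChartedSpace.atlas, mem_iUnion, mem_singleton_iff] at he he'
  obtain ⟨_, ⟨α, rfl⟩, rfl⟩ := he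
  obtain ⟨_, ⟨β, rfl⟩, rfl⟩ := he'
  intro z hz
  exact (transition_source_eventually α β hz.1).2.contDiffAt.contDiffWithinAt

section

variable {E : Type*} [NormedAddCommGroup E] [NormedSpace ℝ E] {H : Type*} [TopologicalSpace H]
  {I : ModelWithCorners ℝ E H} {X : Type*} [TopologicalSpace X] [ChartedSpace H X]

theorem PlotAt.contMDiffAt {f : X → L.Completion} {x₀ : X} (h : PlotAt I f x₀) :
    ContMDiffAt I (𝓡 n) ∞ f x₀ := by
  obtain ⟨h1, h2⟩ := h.chart (chartData (f x₀)) (chartData (f x₀)).mem_domain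
  have h3 : ContMDiffAt (𝓡 n) (𝓡 n) ∞ (chartAt (EuclideanSpace ℝ (Fin n)) (f x₀)).symm
      ((chartData (f x₀)).toFun (f x₀)) :=
    contMDiffAt_chartAt_symm ((chartAt _ (f x₀)).map_source (mem_chart_source _ (f x₀)))
  refine (ContMDiffAt.comp x₀ (f := fun x => (chartData (f x₀)).toFun (f x)) h3
    h2).congr_of_eventuallyEq ?_
  filter_upwards [h1] with x hx
  exact ((chartData (f x₀)).toPartialEquiv.left_inv hx).symm

theorem plotAt_id (α : L.Completion) : PlotAt (𝓡 n) (fun β : L.Completion => β) α := by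
  have h1 : ContMDiffAt (𝓡 n) (𝓡 n) ∞ (chartAt (EuclideanSpace ℝ (Fin n)) α) α :=
    contMDiffAt_chartAt (mem_chart_source _ α)
  have h2 := ((chartData α).eventually_mem_codomain
    ((chartData α).toPartialEquiv.map_source (chartData α).mem_domain)).2
  refine (PlotAt.comp (f := (chartData α).invFun) (φ := chartAt (EuclideanSpace ℝ (Fin n)) α)
    h2 h1).congr ?_
  filter_upwards [chart_source_mem_nhds (EuclideanSpace ℝ (Fin n)) α] with β hβ
  exact ((chartData α).toPartialEquiv.left_inv hβ).symm

/-- Smooth maps to the completion are those that are locally given by smooth words. -/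
theorem plotAt_iff {f : X → L.Completion} {x₀ : X} :
    PlotAt I f x₀ ↔ ContMDiffAt I (𝓡 n) ∞ f x₀ :=
  ⟨PlotAt.contMDiffAt, fun h => (plotAt_id (f x₀)).comp h⟩

end

theorem contMDiff_src : ContMDiff (𝓡 n) (𝓡 k) ∞ (src : L.Completion → M) :=
  fun α => (plotAt_id α).contMDiffAt_src

theorem contMDiff_tgt : ContMDiff (𝓡 n) (𝓡 k) ∞ (tgt : L.Completion → M) :=
  fun α => (plotAt_id α).contMDiffAt_tgt

theorem contMDiff_inv : ContMDiff (𝓡 n) (𝓡 n) ∞ (inv : L.Completion → L.Completion) :=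
  fun α => (plotAt_id α).inv.contMDiffAt

theorem contMDiff_of : ContMDiff (𝓡 n) (𝓡 n) ∞ (of : G → L.Completion) :=
  fun _ => (plotAt_of contMDiffAt_id).contMDiffAt

theorem surjective_mfderiv_of_section {f : L.Completion → M} (hf : ContMDiff (𝓡 n) (𝓡 k) ∞ f)
    {α : L.Completion} {σ : M → L.Completion} (hσ : ContMDiffAt (𝓡 k) (𝓡 n) ∞ σ (f α))
    (hσα : σ (f α) = α) (h : ∀ᶠ y in 𝓝 (f α), f (σ y) = y) :
    Function.Surjective (mfderiv (𝓡 n) (𝓡 k) f α) := by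
  have h1 := ((hf.contMDiffAt (x := σ (f α))).mdifferentiableAt (by simp)).hasMFDerivAt.comp (f α)
    (hσ.mdifferentiableAt (by simp)).hasMFDerivAt
  have h2 : f ∘ σ =ᶠ[𝓝 (f α)] id := h
  have h3 := h1.congr_of_eventuallyEq h2.symm
  have h4 := hasMFDerivAt_unique h3 (hasMFDerivAt_id (f α))
  rw [hσα] at h4
  intro b
  exact ⟨mfderiv (𝓡 k) (𝓡 n) σ (f α) b, DFunLike.congr_fun h4 b⟩

theorem isSmoothSubmersion_src :
    IsSmoothSubmersion (n := n) (k := k) (src : L.Completion → M) := by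
  refine ⟨contMDiff_src, fun α => ?_⟩
  obtain ⟨τ, D, hD, h1, h2, h3⟩ := exists_section α
  exact surjective_mfderiv_of_section contMDiff_src (h3 _ h1).2.contMDiffAt h2
    (by filter_upwards [hD.mem_nhds h1] with y hy using (h3 y hy).1)

theorem isSmoothSubmersion_tgt :
    IsSmoothSubmersion (n := n) (k := k) (tgt : L.Completion → M) := by
  refine ⟨contMDiff_tgt, fun α => ?_⟩
  obtain ⟨τ, D, hD, h1, h2, h3⟩ := exists_section (inv α)
  rw [src_inv] at h1 h2
  refine surjective_mfderiv_of_section (σ := fun y => inv (τ y)) contMDiff_tgt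
    (h3 _ h1).2.inv.contMDiffAt (by rw [h2, inv_inv]) ?_
  filter_upwards [hD.mem_nhds h1] with y hy
  rw [tgt_inv, (h3 y hy).1]

/-- Products of plots need composability on a full neighbourhood, whereas composable pairs form a
thin set. The retraction `ρ` moves the first factor to one whose source is the target of the second.
The product so modified is smooth on a neighbourhood and agrees with the original one on composable
pairs. -/
theorem contMDiffOn_mul : ContMDiffOn ((𝓡 n).prod (𝓡 n)) (𝓡 n) ∞
    (fun p : L.Completion × L.Completion => mul p.1 p.2) {p | src p.1 = tgt p.2} := by
  rintro ⟨α, β⟩ hαβ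
  obtain ⟨ρ, h1, h2, h3, h4⟩ := isSmoothSubmersion_src.exists_retraction α
  replace hαβ : src α = tgt β := hαβ
  let φ : L.Completion × L.Completion → L.Completion × M := fun p => (p.1, tgt p.2)
  have hφ : ContMDiffAt ((𝓡 n).prod (𝓡 n)) ((𝓡 n).prod (𝓡 k)) ∞ φ (α, β) :=
    contMDiffAt_fst.prodMk
      (ContMDiffAt.comp (α, β) (g := tgt) contMDiff_tgt.contMDiffAt contMDiffAt_snd)
  have hφ₀ : φ (α, β) = (α, src α) := by simp [φ, hαβ]
  have hρ : ContMDiffAt ((𝓡 n).prod (𝓡 n)) (𝓡 n) ∞ (fun p => ρ (φ p)) (α, β) :=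
    ContMDiffAt.comp (α, β) (g := ρ) (by rwa [hφ₀]) hφ
  have hφt : Tendsto φ (𝓝 (α, β)) (𝓝 (α, src α)) := hφ₀ ▸ hφ.continuousAt.tendsto
  have hm : ContMDiffAt ((𝓡 n).prod (𝓡 n)) (𝓡 n) ∞ (fun p => mul (ρ (φ p)) p.2) (α, β) :=
    ((plotAt_iff.2 hρ).mul (plotAt_iff.2 contMDiffAt_snd) (hφt.eventually h3)).contMDiffAt
  have h5 : ∀ᶠ p : L.Completion × L.Completion in 𝓝 (α, β), ρ (p.1, src p.1) = p.1 :=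
    (continuous_fst.tendsto (α, β)).eventually h4
  refine hm.contMDiffWithinAt.congr_of_eventuallyEq ?_ ?_
  · filter_upwards [mem_nhdsWithin_of_mem_nhds h5, self_mem_nhdsWithin] with p h6 h7
    replace h7 : src p.1 = tgt p.2 := h7
    simp only [φ]
    rw [← h7, h6]
  · simp only [φ]
    rw [← hαβ, h2]

theorem continuousOn_mul : ContinuousOn
    (fun p : L.Completion × L.Completion => mul p.1 p.2) {p | src p.1 = tgt p.2} :=
  contMDiffOn_mul.continuousOn

/-- The identity of the completion is a plot, so near an arrow of `G` every element is an arrow of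
`G`, close to the given one. -/
theorem isOpenMap_of : IsOpenMap (of : G → L.Completion) := by
  intro U hU
  refine isOpen_iff_eventually.2 ?_
  rintro _ ⟨g, hg, rfl⟩
  obtain ⟨h1, h2⟩ := (plotAt_id (of g : L.Completion)).contMDiffAt_toArrow ⟨g, rfl⟩
  filter_upwards [h2, h1.continuousAt.eventually_mem (hU.mem_nhds (by rwa [toArrow_of]))]
    with α h3 h4
  exact ⟨_, h4, h3.symm⟩

/-! ### Second countability and Hausdorff fibres -/

/-- Elements represented by words of a given length lie in the continuous image of an iterated fibre
product of copies of `G`, which is second countable. So the completion is a countable union of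
Lindelöf sets and is covered by countably many charts. -/
theorem secondCountableTopology [SecondCountableTopology G] :
    SecondCountableTopology L.Completion := by
  have key : ∀ m : ℕ, ∃ (Y : Type u) (_ : TopologicalSpace Y) (_ : SecondCountableTopology Y)
      (f : Y → L.Completion), Continuous f ∧
      ∀ (w : List G) (α : L.Completion), w.length = m + 1 → Rep w α → α ∈ range f := by
    intro m
    induction m with
    | zero =>
      refine ⟨G, _, inferInstance, of, contMDiff_of.continuous, fun w α hw h => ?_⟩
      obtain ⟨g, rfl⟩ := List.length_eq_one_iff.1 hw
      exact ⟨g, (rep_of g).eq h⟩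
    | succ m ih =>
      obtain ⟨Y, _, _, f, hf, hfr⟩ := ih
      refine ⟨{p : G × Y // L.source p.1 = tgt (f p.2)}, instTopologicalSpaceSubtype,
        TopologicalSpace.Subtype.secondCountableTopology {p : G × Y | L.source p.1 = tgt (f p.2)},
        fun p => mul (of p.1.1) (f p.1.2), ?_, fun w α hw h => ?_⟩
      · exact continuousOn_mul.comp_continuous
          (f := fun p : {p : G × Y // L.source p.1 = tgt (f p.2)} => (of p.1.1, f p.1.2))
          ((contMDiff_of.continuous.comp (continuous_fst.comp continuous_subtype_val)).prodMk
            (hf.comp (continuous_snd.comp continuous_subtype_val)))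
          (fun p => by simpa using p.2)
      · match w, hw with
        | g :: w, hw =>
          rcases h.eq_or with ⟨rfl, -⟩ | ⟨β, h1, h2, rfl⟩
          · simp at hw
          · obtain ⟨y, rfl⟩ := hfr w β (by simpa using hw) h1
            exact ⟨⟨(g, y), h2⟩, rfl⟩
  choose Y _ _ f hf hfr using key
  have hL : IsLindelof (univ : Set L.Completion) := by
    have h1 : (⋃ m, range (f m)) = univ := by
      refine eq_univ_of_forall fun α => ?_
      obtain ⟨w, hw⟩ := exists_rep α
      have := List.length_pos_iff.2 hw.isWord.ne_nil
      exact mem_iUnion.2 ⟨w.length - 1, hfr _ w α (by omega) hw⟩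
    rw [← h1]
    exact isLindelof_iUnion fun m => isLindelof_range (hf m)
  obtain ⟨s, hs, hcov⟩ := hL.elim_nhds_subcover'
    (fun α _ => (chartAt (EuclideanSpace ℝ (Fin n)) α).source)
    (fun α _ => chart_source_mem_nhds _ α)
  refine ChartedSpace.secondCountable_of_countable_cover (EuclideanSpace ℝ (Fin n))
    (s := Subtype.val '' s) ?_ (hs.image _)
  refine eq_univ_of_univ_subset (hcov.trans ?_)
  simp only [iUnion_subset_iff]
  intro α hα
  exact subset_biUnion_of_mem (u := fun α => (chartAt (EuclideanSpace ℝ (Fin n)) α).source)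
    (mem_image_of_mem _ hα)

/-- Elements with different targets are separated in `M`. Otherwise `γ = α β⁻¹` is not a unit, and
some open `B` contains the unit at `tgt α` but not `γ`: the image of `G` if `γ` lies outside it, and
otherwise the image of an open set provided by the Hausdorff source fibre of `G`. The map `(η, ζ) ↦
(η α⁻¹)⁻¹ (ζ β⁻¹)` takes `(α, β)` to that unit, but every diagonal point `(η, η)` to `γ`. Hence
neighbourhoods of `α` and `β` whose pairs with equal targets are sent into `B` must be disjoint. -/
theorem t2_source_fiber [T2Space M] (x : M) : T2Space (src ⁻¹' {x} : Set L.Completion) := by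
  refine ⟨fun α β hne => ?_⟩
  have hcont : ∀ γ : (src ⁻¹' {x} : Set L.Completion),
      Continuous fun δ : (src ⁻¹' {x} : Set L.Completion) => mul δ.1 (inv γ.1) := fun γ =>
    continuousOn_mul.comp_continuous
      (f := fun δ : (src ⁻¹' {x} : Set L.Completion) => (δ.1, inv γ.1))
      (continuous_subtype_val.prodMk continuous_const)
      fun δ => (δ.2 : src δ.1 = x).trans ((tgt_inv γ.1).trans γ.2).symm
  have hsrc : ∀ γ δ : (src ⁻¹' {x} : Set L.Completion), src δ.1 = tgt (inv γ.1) := fun γ δ =>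
    (δ.2 : src δ.1 = x).trans ((tgt_inv γ.1).trans γ.2).symm
  by_cases ht : tgt α.1 = tgt β.1
  swap
  · obtain ⟨U, V, hU, hV, h1, h2, h3⟩ := t2_separation ht
    have hc : Continuous fun δ : (src ⁻¹' {x} : Set L.Completion) => tgt δ.1 :=
      contMDiff_tgt.continuous.comp continuous_subtype_val
    exact ⟨_, _, hU.preimage hc, hV.preimage hc, h1, h2, h3.preimage _⟩
  obtain ⟨B, hB, hB1, hB2⟩ : ∃ B : Set L.Completion, IsOpen B ∧ of (L.unit (tgt α.1)) ∈ B ∧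
      mul α.1 (inv β.1) ∉ B := by
    by_cases hγ : mul α.1 (inv β.1) ∈ range of
    swap
    · exact ⟨range of, isOpenMap_of.isOpen_range, mem_range_self _, hγ⟩
    obtain ⟨c, hc⟩ := hγ
    have hsc : L.source c = tgt α.1 := by
      rw [← src_of (L := L), hc, src_mul (hsrc β α), src_inv, ht]
    have hne' : c ≠ L.unit (tgt α.1) := by
      rintro rfl
      apply hne
      rw [Subtype.ext_iff, ← unit_mul β.1, ← ht, hc,
        mul_inv_mul ((α.2 : src α.1 = x).trans (β.2 : src β.1 = x).symm)]
    have := L.t2_source_fiber (tgt α.1)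
    have hne2 : (⟨L.unit (tgt α.1), L.source_unit _⟩ : L.source ⁻¹' {tgt α.1}) ≠ ⟨c, hsc⟩ :=
      fun h => hne' (congrArg Subtype.val h).symm
    obtain ⟨_, ⟨V, hV, rfl⟩, h1, h2⟩ := t1Space_iff_exists_open.1 inferInstance hne2
    refine ⟨of '' V, isOpenMap_of V hV, mem_image_of_mem _ h1, ?_⟩
    rw [← hc]
    rintro ⟨c', hc', h3⟩
    rw [of_injective h3] at hc'
    exact h2 hc'
  -- Equality of targets is what makes the two factors below composable, and it holds on the
  -- diagonal, where the contradiction arises.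
  let S : Set ((src ⁻¹' {x} : Set L.Completion) × (src ⁻¹' {x} : Set L.Completion)) :=
    {p | tgt p.1.1 = tgt p.2.1}
  have hK : ContinuousOn (fun p : (src ⁻¹' {x} : Set L.Completion) ×
      (src ⁻¹' {x} : Set L.Completion) =>
      mul (inv (mul p.1.1 (inv α.1))) (mul p.2.1 (inv β.1))) S := by
    refine continuousOn_mul.comp (f := fun p : (src ⁻¹' {x} : Set L.Completion) ×
      (src ⁻¹' {x} : Set L.Completion) => (inv (mul p.1.1 (inv α.1)), mul p.2.1 (inv β.1)))
      (((contMDiff_inv.continuous.comp ((hcont α).comp continuous_fst)).prodMk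
        ((hcont β).comp continuous_snd)).continuousOn) fun p hp => ?_
    replace hp : tgt p.1.1 = tgt p.2.1 := hp
    simp [tgt_mul (hsrc _ _), hp]
  have hK₀ := (hK (α, β) ht).tendsto
  have hval : mul (inv (mul α.1 (inv α.1))) (mul β.1 (inv β.1)) = of (L.unit (tgt α.1)) := by
    rw [mul_inv, mul_inv, ← ht]
    have h1 := inv_mul (of (L.unit (tgt α.1)) : L.Completion)
    rwa [src_of, L.source_unit] at h1
  rw [hval] at hK₀
  have h1 := eventually_nhdsWithin_iff.1 (hK₀.eventually_mem (hB.mem_nhds hB1))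
  obtain ⟨U, V, hU, hαU, hV, hβV, hUV⟩ := mem_nhds_prod_iff'.1 h1
  refine ⟨U, V, hU, hV, hαU, hβV, Set.disjoint_left.2 fun η h2 h3 => hB2 ?_⟩
  have h4 := hUV (mk_mem_prod h2 h3) rfl
  dsimp only at h4
  have h5 : inv (mul η.1 (inv α.1)) = mul α.1 (inv η.1) := by
    refine (isInverse_inv _).unique ?_
    have := (isInverse_inv η.1).comp (isInverse_inv α.1).symm (hsrc α η)
    exact this
  rwa [h5, mul_assoc (hsrc η α) (by rw [src_inv, tgt_mul (hsrc β η)]),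
    ← mul_assoc (src_inv η.1) (hsrc β η), inv_mul, hsrc β η, unit_mul] at h4

theorem t2_target_fiber [T2Space M] (x : M) : T2Space (tgt ⁻¹' {x} : Set L.Completion) := by
  have := t2_source_fiber (L := L) x
  refine T2Space.of_injective_continuous
    (f := fun α : (tgt ⁻¹' {x} : Set L.Completion) =>
      (⟨inv α.1, by rw [mem_preimage, src_inv]; exact α.2⟩ : (src ⁻¹' {x} : Set L.Completion))) ?_ ?_
  · intro α β h
    have h1 : inv α.1 = inv β.1 := congrArg Subtype.val h
    rw [Subtype.ext_iff, ← inv_inv α.1, h1, inv_inv]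
  · exact Continuous.subtype_mk (contMDiff_inv.continuous.comp continuous_subtype_val) _

/-! ### The Lie groupoid -/

variable (L) in
/-- The completion is a Lie groupoid. -/
noncomputable def lieGroupoid [T2Space M] : LieGroupoid n k L.Completion M where
  source := src
  target := tgt
  unit x := of (L.unit x)
  mul := mul
  inv := inv
  t2_source_fiber := t2_source_fiber
  t2_target_fiber := t2_target_fiber
  source_submersion := isSmoothSubmersion_src
  target_submersion := isSmoothSubmersion_tgt
  unit_smooth := contMDiff_of.comp L.unit_smooth
  mul_smooth := contMDiffOn_mul
  inv_smooth := contMDiff_inv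
  source_unit x := by simp [L.source_unit]
  target_unit x := by simp [L.target_unit]
  source_mul _ _ := src_mul
  target_mul _ _ := tgt_mul
  mul_assoc _ _ _ := mul_assoc
  mul_unit := mul_unit
  unit_mul := unit_mul
  source_inv := src_inv
  target_inv := tgt_inv
  inv_mul := inv_mul
  mul_inv := mul_inv

end LocalLieGroupoid.Completion

namespace LocalLieGroupoid

/-! ### Globalizable implies globally associative -/

section Easy

variable {n k : ℕ} {G : Type u} {M : Type v}
  [TopologicalSpace G] [ChartedSpace (EuclideanSpace ℝ (Fin n)) G]
  [TopologicalSpace M] [ChartedSpace (EuclideanSpace ℝ (Fin k)) M]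
  {L : LocalLieGroupoid n k G M}

/-- In a globalization, the value of a word acts as the letters of the word do. -/
theorem Evaluates.foldr_eq {A : Type u} [TopologicalSpace A]
    [ChartedSpace (EuclideanSpace ℝ (Fin n)) A] {Γ : LieGroupoid n k A M}
    {U : TopologicalSpace.Opens A} {Φ : G ≃ₘ⟮𝓡 n, 𝓡 n⟯ U} (h : L.IsRestrictionOf Γ U Φ)
    {w : List G} {g : G} (hw : L.Evaluates w g) {a : A} (ha : Γ.target a = L.source g) :
    w.foldr (fun g b => Γ.mul (Φ g) b) a = Γ.mul (Φ g) a := by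
  induction hw generalizing a with
  | single g => rfl
  | @mul w₁ w₂ g h' _ _ hgh ih1 ih2 =>
    have h1 := source_eq_target_of_mem hgh
    rw [L.source_mul _ _ hgh] at ha
    rw [List.foldr_append, ih2 ha, ih1, h.mul_eq _ _ hgh, Γ.mul_assoc]
    · rw [h.source_eq, h.target_eq, h1]
    · rw [h.source_eq, ha]
    · rw [Γ.target_mul _ _ (by rw [h.source_eq, ha]), h.target_eq, h1]

theorem IsGlobalizable.isGloballyAssociative (h : L.IsGlobalizable) :
    L.IsGloballyAssociative := by
  obtain ⟨A, _, _, -, -, Γ, U, Φ, h⟩ := h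
  intro N _ m hm _ w hw g g' hg hg'
  have hs : L.source g = L.source g' := (hg.isWord.unique hg'.isWord).2
  -- Letting the letters act in turn on a unit gives an element of `Γ` that depends on the word
  -- alone, and any value of the word has it as image under `Φ`.
  have h1 := hg.foldr_eq h (a := Γ.unit (L.source g)) (Γ.target_unit _)
  have h2 := hg'.foldr_eq h (a := Γ.unit (L.source g)) (by rw [Γ.target_unit, hs])
  rw [h1] at h2
  have h3 : (Φ g : A) = Φ g' := by
    rw [← Γ.mul_unit (Φ g), ← Γ.mul_unit (Φ g'), h.source_eq, h.source_eq, ← hs, h2]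
  exact Φ.injective (Subtype.ext h3)

end Easy

variable {n k : ℕ} {G : Type u} {M : Type v}
  [TopologicalSpace G] [ChartedSpace (EuclideanSpace ℝ (Fin n)) G] [IsManifold (𝓡 n) ∞ G]
  [TopologicalSpace M] [ChartedSpace (EuclideanSpace ℝ (Fin k)) M] [IsManifold (𝓡 k) ∞ M]
  {L : LocalLieGroupoid n k G M} [L.IsGlobal]

/-! ### `G` as an open subset of its completion -/

namespace Completion

variable (L) in
/-- The open subset of the completion formed by the arrows of `G`. -/
def arrows : TopologicalSpace.Opens L.Completion := ⟨range of, isOpenMap_of.isOpen_range⟩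

variable (L) in
/-- `G` is diffeomorphic to an open subset of its completion. -/
noncomputable def ofDiffeomorph : G ≃ₘ⟮𝓡 n, 𝓡 n⟯ (arrows L) where
  toEquiv := Equiv.ofInjective of of_injective
  contMDiff_toFun := (ContMDiff.subtypeVal_comp_iff _ _).1 contMDiff_of
  contMDiff_invFun := by
    have h1 : ∀ α : arrows L, (Equiv.ofInjective of of_injective).symm α = toArrow α.1 := by
      rintro ⟨_, g, rfl⟩
      rw [toArrow_of]
      exact Equiv.ofInjective_symm_apply of_injective g
    intro α
    have h2 := ((plotAt_id α.1).contMDiffAt_toArrow α.2).1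
    exact (contMDiffAt_subtype_iff.2 h2).congr_of_eventuallyEq (.of_forall h1)

theorem isRestrictionOf [T2Space M] :
    L.IsRestrictionOf (lieGroupoid L) (arrows L) (ofDiffeomorph L) where
  unit_mem x := ⟨L.unit x, rfl⟩
  source_eq := src_of
  target_eq := tgt_of
  unit_eq _ := rfl
  mul_eq _ _ h := (of_mul_of h).symm
  inv_eq _ h := (isInverse_of h).unique (isInverse_inv _)

end Completion

end LocalLieGroupoid

end

theorem mainTheorem2 {n k : ℕ} {G : Type u} {M : Type v}
    [TopologicalSpace G] [ChartedSpace (EuclideanSpace ℝ (Fin n)) G] [IsManifold (𝓡 n) ∞ G]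
    [SecondCountableTopology G]
    [TopologicalSpace M] [ChartedSpace (EuclideanSpace ℝ (Fin k)) M] [IsManifold (𝓡 k) ∞ M]
    [T2Space M] [SecondCountableTopology M]
    (L : LocalLieGroupoid n k G M) (hL : L.IsStronglyConnected) :
    L.IsGlobalizable ↔ L.IsGloballyAssociative := by
  refine ⟨fun h => h.isGloballyAssociative, fun hA => ?_⟩
  have : L.IsGlobal := ⟨hA, hL⟩
  exact ⟨L.Completion, inferInstance, inferInstance, inferInstance,
    LocalLieGroupoid.Completion.secondCountableTopology, _, _, _,
    LocalLieGroupoid.Completion.isRestrictionOf⟩
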